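/- **Theorem (Decomposition Theorem).** Let $L$ be a complex separable Hilbert space whose inner product $\{\cdot,\cdot\}$ is linear in the second argument, and let $(\zeta_i)_{i\in I}$ be an orthonormal basis of $L$. Let $\mathcal F$ be the fermionic Fock space over $L$ with annihilation operators $a_\xi$ (linear in $\xi\in L$) and creation operators $a_\xi^\dagger$ (conjugate linear in $\xi$), so that $a_\xi a_\tau+a_\tau a_\xi=0$ and $a_\xi^\dagger a_\tau+a_\tau a_\xi^\dagger=\{\xi,\tau\}\mathbf 1$; thus $\mathcal F$ is the Hilbert space completion of the exterior algebra of $L^*\cong\overline L$, with $a_\xi^\dagger$ the exterior multiplication by $\{\xi,\cdot\}\in L^*$. All operators on $\mathcal F$ below are bounded, and convergence of operators is in the operator norm. Consider the following sets of bounded operators on $\mathcal F$. * $\mathfrak h^{\mathbb C}$: the operators $\hat\lambda=\frac12\sum_{i}\bigl(a_{\zeta_i}^\dagger a_{\lambda\zeta_i}-a_{\lambda\zeta_i}a_{\zeta_i}^\dagger\bigr)$ with $\lambda$ a trace class operator on $L$. * $\mathfrak m_+$: the operators $\hat\Lambda=\frac12\sum_i a_{\zeta_i}a_{\Lambda\zeta_i}$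 with $\Lambda\in\Xi(L)$, where $\Xi(L)$ is the set of real linear maps $\Lambda:L\to L$ such that $\{\xi,\Lambda\tau\}=-\{\tau,\Lambda\xi\}$ for all $\xi,\tau\in L$ and $\Lambda^2$ is trace class, and where $\Lambda$ is such that the series converges (so that $\hat\Lambda$ is a bounded operator); $\mathfrak m_-=\{x^\dagger: x\in\mathfrak m_+\}$. * $\mathfrak n_+$: the operators $\hat\xi=\frac1{\sqrt2}a_\xi$ with $\xi\in L$; $\mathfrak n_-=\{x^\dagger: x\in\mathfrak n_+\}$. * $\mathfrak p_\pm=\mathfrak m_\pm\oplus\mathfrak n_\pm$ and $\mathfrak g^{\mathbb C}=\mathfrak h^{\mathbb C}\oplus\mathfrak m_+\oplus\mathfrak m_-\oplus\mathfrak n_+\oplus\mathfrak n_-$. Let $P_\pm=\exp(\mathfrak p_\pm)$ and $H^{\mathbb C}=\exp(\mathfrak h^{\mathbb C})$ be the sets of exponentials. Let $G^{\mathbb C}$ be the set of those operators in the operator norm closure of the set of all finite products of exponentials of elements of $\mathfrak g^{\mathbb C}$ which are invertible. Then $phq\in G^{\mathbb C}$ for all $p\in P_-$, $h\in H^{\mathbb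 C}$, $q\in P_+$, and the multiplication map $$P_-\times H^{\mathbb C}\times P_+\to G^{\mathbb C},\qquad (p,h,q)\mapsto phq,$$ is injective and has dense image in $G^{\mathbb C}$ in the operator norm topology. -/

import Mathlib

open scoped InnerProductSpace Pointwise

namespace FermiFock

noncomputable section

/-! ### The fermionic Fock space -/

section Fock

/-- The space of vectors with finitely many particles: the algebraic exterior algebra of the
one-particle space `L* = StrongDual ℂ L` (which is the complex conjugate of `L`, via
`ξ ↦ ⟪ξ, ·⟫`). The one-particle space is `L*` and not `L` because in the convention used here
annihilation operators depend linearly, and creation operators conjugate linearly, on `ξ ∈ L`. -/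
abbrev PreFock (L : Type*) [NormedAddCommGroup L] [InnerProductSpace ℂ L] : Type _ :=
  ExteriorAlgebra ℂ (StrongDual ℂ L)

variable {L : Type*} [NormedAddCommGroup L] [InnerProductSpace ℂ L]

/-- Interior multiplication of exterior forms by `ξ ∈ L`. -/
def contract (ξ : L) : PreFock L →ₗ[ℂ] PreFock L :=
  CliffordAlgebra.contractLeft (Q := (0 : QuadraticForm ℂ (StrongDual ℂ L)))
    (ContinuousLinearMap.apply ℂ ℂ ξ : StrongDual ℂ L →L[ℂ] ℂ).toLinearMap

/-- The vacuum component. -/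
def vac : PreFock L →ₐ[ℂ] ℂ := ExteriorAlgebra.algebraMapInv

lemma contract_algebraMap (ξ : L) (r : ℂ) :
    contract ξ (algebraMap ℂ (PreFock L) r) = 0 :=
  CliffordAlgebra.contractLeft_algebraMap (0 : QuadraticForm ℂ (StrongDual ℂ L)) _ r

lemma contract_contract (ξ : L) (x : PreFock L) : contract ξ (contract ξ x) = 0 :=
  CliffordAlgebra.contractLeft_contractLeft (Q := (0 : QuadraticForm ℂ (StrongDual ℂ L))) _ _

lemma contract_add (ξ τ : L) : contract (ξ + τ) = contract ξ + contract τ := by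
  simp only [contract, map_add, ContinuousLinearMap.toLinearMap_add]

lemma contract_smul (c : ℂ) (ξ : L) : contract (c • ξ) = c • contract ξ := by
  simp only [contract, map_smul, ContinuousLinearMap.toLinearMap_smul]

/-- The opposite endomorphism algebra, with the complex conjugate scalar multiplication. -/
def ConjOp (L : Type*) [NormedAddCommGroup L] [InnerProductSpace ℂ L] : Type _ :=
  (Module.End ℂ (PreFock L))ᵐᵒᵖ

instance : Ring (ConjOp L) := inferInstanceAs (Ring (Module.End ℂ (PreFock L))ᵐᵒᵖ)

instance : Algebra ℂ (ConjOp L) :=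
  Algebra.compHom (Module.End ℂ (PreFock L))ᵐᵒᵖ (starRingEnd ℂ)

/-- `ConjOp.mk T` is `T` regarded as an element of `ConjOp L`. -/
def ConjOp.mk (T : Module.End ℂ (PreFock L)) : ConjOp L := MulOpposite.op T

/-- The endomorphism underlying an element of `ConjOp L`. -/
def ConjOp.out (T : ConjOp L) : Module.End ℂ (PreFock L) := MulOpposite.unop T

lemma ConjOp.smul_mk (c : ℂ) (T : Module.End ℂ (PreFock L)) :
    c • ConjOp.mk T = ConjOp.mk (starRingEnd ℂ c • T) := rfl

lemma ConjOp.out_mul (S T : ConjOp L) : (S * T).out = T.out * S.out := rfl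

lemma ConjOp.out_add (S T : ConjOp L) : (S + T).out = S.out + T.out := rfl

lemma ConjOp.out_smul (c : ℂ) (T : ConjOp L) : (c • T).out = starRingEnd ℂ c • T.out := rfl

variable [CompleteSpace L]

/-- The one-particle vector `⟪ξ, ·⟫ ∈ L*`, as an element of the exterior algebra. -/
def ptl (ξ : L) : PreFock L := ExteriorAlgebra.ι ℂ (InnerProductSpace.toDual ℂ L ξ)

lemma contract_ptl_mul (ξ τ : L) (x : PreFock L) :
    contract ξ (ptl τ * x) = ⟪τ, ξ⟫_ℂ • x - ptl τ * contract ξ x :=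
  CliffordAlgebra.contractLeft_ι_mul (Q := (0 : QuadraticForm ℂ (StrongDual ℂ L))) _ _ _

lemma vac_ptl_mul (ξ : L) (x : PreFock L) : vac (ptl ξ * x) = 0 := by
  have h : vac (ptl ξ) = 0 := by
    rw [vac, ptl, ExteriorAlgebra.algebraMapInv, ExteriorAlgebra.lift_ι_apply]; rfl
  rw [map_mul, h, zero_mul]

lemma ptl_mul_ptl (ξ : L) : ptl ξ * ptl ξ = 0 := ExteriorAlgebra.ι_sq_zero _

lemma ptl_anticomm (ξ τ : L) : ptl ξ * ptl τ = -(ptl τ * ptl ξ) :=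
  eq_neg_of_add_eq_zero_left (ExteriorAlgebra.ι_add_mul_swap _ _)

lemma ptl_add (ξ τ : L) : ptl (ξ + τ) = ptl ξ + ptl τ := by simp only [ptl, map_add]

lemma ptl_smul (c : ℂ) (ξ : L) : ptl (c • ξ) = (starRingEnd ℂ c) • ptl ξ := by
  rw [ptl, ptl, LinearIsometryEquiv.map_smulₛₗ, map_smul]

lemma PreFock.induction {P : PreFock L → Prop} (hr : ∀ r : ℂ, P (algebraMap ℂ _ r))
    (hadd : ∀ x y, P x → P y → P (x + y)) (hmul : ∀ ξ x, P x → P (ptl ξ * x))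
    (x : PreFock L) : P x := by
  refine CliffordAlgebra.left_induction (Q := (0 : QuadraticForm ℂ (StrongDual ℂ L)))
    (P := P) hr hadd (fun x m hx => ?_) x
  have := hmul ((InnerProductSpace.toDual ℂ L).symm m) x hx
  rw [ptl, LinearIsometryEquiv.apply_symm_apply] at this
  exact this

/-- The linear map sending `⟪ξ, ·⟫ ∈ L*` to the interior multiplication by `ξ`. -/
def contractLin : StrongDual ℂ L →ₗ[ℂ] ConjOp L where
  toFun φ := ConjOp.mk (contract ((InnerProductSpace.toDual ℂ L).symm φ))
  map_add' φ ψ := by rw [map_add, contract_add]; rfl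
  map_smul' c φ := by rw [LinearIsometryEquiv.map_smulₛₗ, contract_smul]; rfl

lemma contractLin_sq (φ : StrongDual ℂ L) : contractLin φ * contractLin φ = 0 :=
  MulOpposite.unop_injective (LinearMap.ext fun x => contract_contract _ x)

/-- The conjugate linear anti-homomorphism from the exterior algebra of `L*` to operators which
sends `⟪ξ, ·⟫` to the interior multiplication by `ξ`. -/
def contractHom : PreFock L →ₐ[ℂ] ConjOp L :=
  ExteriorAlgebra.lift ℂ ⟨contractLin, contractLin_sq⟩

/-- The sesquilinear form on the exterior algebra of `L*`, with
`⟨φ₁ ∧ ⋯ ∧ φₘ, ψ₁ ∧ ⋯ ∧ ψₙ⟩ = δₘₙ det ⟨φᵢ, ψⱼ⟩`. -/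
def form (x y : PreFock L) : ℂ := vac ((contractHom x).out y)

lemma contractHom_ptl (ξ : L) : contractHom (ptl ξ) = ConjOp.mk (contract ξ) := by
  rw [contractHom, ptl, ExteriorAlgebra.lift_ι_apply]
  exact congrArg (fun ζ => ConjOp.mk (contract ζ)) (LinearIsometryEquiv.symm_apply_apply _ ξ)

lemma form_add_left (x y z : PreFock L) : form (x + y) z = form x z + form y z := by
  rw [form, map_add, ConjOp.out_add, LinearMap.add_apply, map_add]; rfl

lemma form_add_right (x y z : PreFock L) : form x (y + z) = form x y + form x z := by
  rw [form, map_add, map_add]; rfl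

lemma form_smul_left (c : ℂ) (x y : PreFock L) : form (c • x) y = starRingEnd ℂ c * form x y := by
  rw [form, map_smul, ConjOp.out_smul, LinearMap.smul_apply, map_smul]; rfl

lemma form_smul_right (c : ℂ) (x y : PreFock L) : form x (c • y) = c * form x y := by
  rw [form, map_smul, map_smul]; rfl

lemma form_zero_left (x : PreFock L) : form 0 x = 0 := by
  simpa using form_smul_left 0 0 x

lemma form_zero_right (x : PreFock L) : form x 0 = 0 := by
  simpa using form_smul_right 0 x 0

lemma form_sub_right (x y z : PreFock L) : form x (y - z) = form x y - form x z := by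
  rw [form, map_sub, map_sub]; rfl

lemma form_sub_left (x y z : PreFock L) : form (x - y) z = form x z - form y z := by
  have h := form_add_left (x - y) y z
  rw [sub_add_cancel] at h
  rw [h, add_sub_cancel_right]

lemma form_one_left (y : PreFock L) : form 1 y = vac y := by
  rw [form, map_one]; rfl

lemma form_algebraMap_left (r : ℂ) (y : PreFock L) :
    form (algebraMap ℂ _ r) y = starRingEnd ℂ r * vac y := by
  rw [Algebra.algebraMap_eq_smul_one, form_smul_left, form_one_left]

lemma form_ptl_mul_left (ξ : L) (x y : PreFock L) :
    form (ptl ξ * x) y = form x (contract ξ y) := by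
  rw [form, map_mul, contractHom_ptl, ConjOp.out_mul]; rfl

lemma form_ptl_mul_right (ξ : L) (x y : PreFock L) :
    form x (ptl ξ * y) = form (contract ξ x) y := by
  induction x using PreFock.induction generalizing y with
  | hr r =>
    rw [form_algebraMap_left, vac_ptl_mul, contract_algebraMap, form_zero_left, mul_zero]
  | hadd x x' hx hx' => rw [form_add_left, hx, hx', map_add, form_add_left]
  | hmul τ x hx =>
    rw [form_ptl_mul_left, contract_ptl_mul, contract_ptl_mul, form_sub_right, form_sub_left,
      form_smul_right, form_smul_left, hx, form_ptl_mul_left, inner_conj_symm]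

lemma form_one_right (x : PreFock L) : form x 1 = starRingEnd ℂ (vac x) := by
  induction x using PreFock.induction with
  | hr r => rw [form_algebraMap_left, AlgHom.commutes, map_one, mul_one]; rfl
  | hadd x y hx hy => rw [form_add_left, hx, hy, map_add, map_add]
  | hmul ξ x _ =>
    rw [form_ptl_mul_left, vac_ptl_mul, ← map_one (algebraMap ℂ (PreFock L)),
      contract_algebraMap, form_zero_right, map_zero]

lemma form_conj_symm (x y : PreFock L) : starRingEnd ℂ (form y x) = form x y := by
  induction x using PreFock.induction generalizing y with
  | hr r =>
    rw [form_algebraMap_left, Algebra.algebraMap_eq_smul_one, form_smul_right, form_one_right,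
      map_mul, Complex.conj_conj]
  | hadd x x' hx hx' => rw [form_add_left, form_add_right, map_add, hx, hx']
  | hmul ξ x hx => rw [form_ptl_mul_left, form_ptl_mul_right, hx]

/-- The span of the ordered products of the one-particle vectors in a list. -/
def products : List L → Submodule ℂ (PreFock L)
  | [] => Submodule.span ℂ {1}
  | v :: l => products l ⊔ (products l).map (LinearMap.mulLeft ℂ (ptl v))

lemma mem_products_cons {v : L} {l : List L} {x : PreFock L} :
    x ∈ products (v :: l) ↔ ∃ y ∈ products l, ∃ z ∈ products l, x = y + ptl v * z := by
  simp only [products, Submodule.mem_sup, Submodule.mem_map, LinearMap.mulLeft_apply]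
  constructor
  · rintro ⟨y, hy, _, ⟨z, hz, rfl⟩, rfl⟩
    exact ⟨y, hy, z, hz, rfl⟩
  · rintro ⟨y, hy, z, hz, rfl⟩
    exact ⟨y, hy, _, ⟨z, hz, rfl⟩, rfl⟩

lemma one_mem_products (l : List L) : (1 : PreFock L) ∈ products l := by
  induction l with
  | nil => exact Submodule.mem_span_singleton_self _
  | cons v l ih => exact (le_sup_left : products l ≤ products (v :: l)) ih

lemma ptl_mul_mem_products {l : List L} {u : L} (hu : u ∈ l) {x : PreFock L}
    (hx : x ∈ products l) : ptl u * x ∈ products l := by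
  induction l generalizing x with
  | nil => simp at hu
  | cons v l ih =>
    obtain ⟨y, hy, z, hz, rfl⟩ := mem_products_cons.1 hx
    rcases List.mem_cons.1 hu with rfl | hu
    · refine mem_products_cons.2 ⟨0, zero_mem _, y, hy, ?_⟩
      rw [mul_add, ← mul_assoc, ptl_mul_ptl, zero_mul, add_zero, zero_add]
    · refine mem_products_cons.2 ⟨_, ih hu hy, _, neg_mem (ih hu hz), ?_⟩
      rw [mul_add, ← mul_assoc, ptl_anticomm u v, neg_mul, mul_assoc, mul_neg]

lemma ptl_mul_mem_products_of_span {l : List L} {u : L}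
    (hu : u ∈ Submodule.span ℂ {v | v ∈ l}) {x : PreFock L} (hx : x ∈ products l) :
    ptl u * x ∈ products l := by
  induction hu using Submodule.span_induction with
  | mem u hu => exact ptl_mul_mem_products hu hx
  | zero =>
    rw [← zero_smul ℂ (0 : L), ptl_smul, map_zero, zero_smul, zero_mul]
    exact zero_mem _
  | add u v _ _ hu hv =>
    rw [ptl_add, add_mul]
    exact add_mem hu hv
  | smul c u _ hu =>
    rw [ptl_smul, smul_mul_assoc]
    exact Submodule.smul_mem _ _ hu

lemma contract_products {l : List L} {v : L} (hv : ∀ u ∈ l, ⟪u, v⟫_ℂ = 0) {x : PreFock L}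
    (hx : x ∈ products l) : contract v x = 0 := by
  induction l generalizing x with
  | nil =>
    obtain ⟨c, rfl⟩ := Submodule.mem_span_singleton.1 hx
    rw [← Algebra.algebraMap_eq_smul_one, contract_algebraMap]
  | cons u l ih =>
    obtain ⟨y, hy, z, hz, rfl⟩ := mem_products_cons.1 hx
    have hl : ∀ w ∈ l, ⟪w, v⟫_ℂ = 0 := fun w hw => hv w (List.mem_cons_of_mem _ hw)
    rw [map_add, contract_ptl_mul, ih hl hy, ih hl hz, hv u List.mem_cons_self, zero_smul,
      mul_zero, sub_zero, add_zero]

lemma form_self_nonneg_of_products {l : List L} (h0 : l.Pairwise fun u v => ⟪u, v⟫_ℂ = 0)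
    (h1 : ∀ v ∈ l, ‖v‖ = 1) {x : PreFock L} (hx : x ∈ products l) : 0 ≤ (form x x).re := by
  induction l generalizing x with
  | nil =>
    obtain ⟨c, rfl⟩ := Submodule.mem_span_singleton.1 hx
    rw [form_smul_left, form_smul_right, form_one_left, map_one, mul_one, mul_comm,
      Complex.mul_conj, Complex.ofReal_re]
    exact Complex.normSq_nonneg c
  | cons v l ih =>
    obtain ⟨y, hy, z, hz, rfl⟩ := mem_products_cons.1 hx
    obtain ⟨hv, hl⟩ := List.pairwise_cons.1 h0
    have hv' : ∀ u ∈ l, ⟪u, v⟫_ℂ = 0 := fun u hu => by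
      rw [← inner_conj_symm, hv u hu, map_zero]
    have hvv : ⟪v, v⟫_ℂ = 1 := by
      rw [inner_self_eq_norm_sq_to_K, h1 v List.mem_cons_self]; simp
    have e : form (y + ptl v * z) (y + ptl v * z) = form y y + form z z := by
      rw [form_add_left, form_add_right, form_ptl_mul_right, form_ptl_mul_left, map_add,
        contract_ptl_mul, contract_products hv' hy, contract_products hv' hz, hvv]
      simp [form_zero_left]
    rw [e, Complex.add_re]
    have hn : ∀ u ∈ l, ‖u‖ = 1 := fun u hu => h1 u (List.mem_cons_of_mem _ hu)
    exact add_nonneg (ih hl hn hy) (ih hl hn hz)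

lemma exists_mem_products (x : PreFock L) : ∃ W : Submodule ℂ L, FiniteDimensional ℂ W ∧
    ∀ l : List L, W ≤ Submodule.span ℂ {v | v ∈ l} → x ∈ products l := by
  induction x using PreFock.induction with
  | hr r =>
    refine ⟨⊥, inferInstance, fun l _ => ?_⟩
    rw [Algebra.algebraMap_eq_smul_one]
    exact Submodule.smul_mem _ _ (one_mem_products l)
  | hadd x y hx hy =>
    obtain ⟨W, hW, hx⟩ := hx
    obtain ⟨W', hW', hy⟩ := hy
    exact ⟨W ⊔ W', inferInstance, fun l hl =>
      add_mem (hx l (le_sup_left.trans hl)) (hy l (le_sup_right.trans hl))⟩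
  | hmul ξ x hx =>
    obtain ⟨W, hW, hx⟩ := hx
    refine ⟨W ⊔ Submodule.span ℂ {ξ}, inferInstance, fun l hl => ?_⟩
    exact ptl_mul_mem_products_of_span
      (hl (le_sup_right (a := W) (Submodule.mem_span_singleton_self ξ)))
      (hx l (le_sup_left.trans hl))

lemma form_self_nonneg (x : PreFock L) : 0 ≤ (form x x).re := by
  obtain ⟨W, hW, hx⟩ := exists_mem_products x
  let e := stdOrthonormalBasis ℂ W
  have ho : Orthonormal ℂ fun i => (e i : L) := e.orthonormal.comp_linearIsometry W.subtypeₗᵢ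
  refine form_self_nonneg_of_products (l := List.ofFn fun i => (e i : L)) ?_ ?_ (hx _ ?_)
  · exact List.pairwise_ofFn.2 fun i j hij => ho.2 hij.ne
  · intro v hv
    obtain ⟨i, rfl⟩ := List.mem_ofFn.1 hv
    exact ho.1 i
  · intro w hw
    have h := e.sum_repr ⟨w, hw⟩
    have h' : ∑ i, e.repr ⟨w, hw⟩ i • (e i : L) = w := by
      simpa using congrArg Subtype.val h
    rw [← h']
    exact Submodule.sum_mem _ fun i _ =>
      Submodule.smul_mem _ _ (Submodule.subset_span (List.mem_ofFn.2 ⟨i, rfl⟩))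

/-- The inner product on finite-particle vectors. -/
@[reducible] def preFockCore : PreInnerProductSpace.Core ℂ (PreFock L) where
  inner x y := form x y
  conj_inner_symm := form_conj_symm
  re_inner_nonneg := form_self_nonneg
  add_left := form_add_left
  smul_left x y r := form_smul_left r x y

instance : SeminormedAddCommGroup (PreFock L) :=
  @InnerProductSpace.Core.toSeminormedAddCommGroup ℂ (PreFock L) _ _ _ preFockCore

instance : InnerProductSpace ℂ (PreFock L) := InnerProductSpace.ofCore preFockCore

lemma preFock_inner (x y : PreFock L) : ⟪x, y⟫_ℂ = form x y := rfl

/-- The fermionic Fock space: the Hilbert space completion of the exterior algebra. -/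
abbrev Fock (L : Type*) [NormedAddCommGroup L] [InnerProductSpace ℂ L] [CompleteSpace L] : Type _ :=
  UniformSpace.Completion (PreFock L)

lemma norm_ptl_mul_le (ξ : L) (x : PreFock L) : ‖ptl ξ * x‖ ≤ ‖ξ‖ * ‖x‖ := by
  have h : form (ptl ξ * x) (ptl ξ * x) + form (contract ξ x) (contract ξ x)
      = ⟪ξ, ξ⟫_ℂ * form x x := by
    rw [form_ptl_mul_left, contract_ptl_mul, form_sub_right, form_smul_right,
      form_ptl_mul_right, sub_add_cancel]
  have h1 : ‖ptl ξ * x‖ ^ 2 = (form (ptl ξ * x) (ptl ξ * x)).re :=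
    norm_sq_eq_re_inner (𝕜 := ℂ) _
  have h2 : ‖x‖ ^ 2 = (form x x).re := norm_sq_eq_re_inner (𝕜 := ℂ) _
  have h3 : (⟪ξ, ξ⟫_ℂ * form x x).re = ‖ξ‖ ^ 2 * ‖x‖ ^ 2 := by
    rw [inner_self_eq_norm_sq_to_K, h2, ← Complex.re_ofReal_mul]
    simp
  have h4 := form_self_nonneg (contract ξ x)
  have h5 := congrArg Complex.re h
  rw [Complex.add_re, h3, ← h1] at h5
  refine le_of_sq_le_sq ?_ (by positivity)
  rw [mul_pow]
  linarith

/-- The creation operator `a_ξ†`: exterior multiplication by `⟪ξ, ·⟫`. -/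
def create (ξ : L) : Fock L →L[ℂ] Fock L :=
  (LinearMap.mkContinuous (LinearMap.mulLeft ℂ (ptl ξ)) ‖ξ‖
    (norm_ptl_mul_le ξ)).completion

/-- The annihilation operator `a_ξ`. -/
def annih (ξ : L) : Fock L →L[ℂ] Fock L := ContinuousLinearMap.adjoint (create ξ)

lemma create_coe (ξ : L) (x : PreFock L) :
    create ξ (x : Fock L) = ((ptl ξ * x : PreFock L) : Fock L) :=
  UniformSpace.Completion.map_coe (ContinuousLinearMap.uniformContinuous _) x

/-- On finite-particle vectors, `a_ξ` is the interior multiplication by `ξ`. -/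
lemma annih_coe (ξ : L) (x : PreFock L) :
    annih ξ (x : Fock L) = ((contract ξ x : PreFock L) : Fock L) := by
  refine ext_inner_left ℂ fun y => ?_
  induction y using UniformSpace.Completion.induction_on with
  | hp => exact isClosed_eq (by fun_prop) (by fun_prop)
  | ih y =>
    rw [annih, ContinuousLinearMap.adjoint_inner_right, create_coe,
      UniformSpace.Completion.inner_coe, UniformSpace.Completion.inner_coe, preFock_inner,
      preFock_inner, form_ptl_mul_left]

lemma op_ext {S T : Fock L →L[ℂ] Fock L} (h : ∀ x : PreFock L, S (x : Fock L) = T (x : Fock L)) :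
    S = T := by
  ext x
  induction x using UniformSpace.Completion.induction_on with
  | hp => exact isClosed_eq S.continuous T.continuous
  | ih x => exact h x

/-- The canonical anticommutation relation `a_ξ† a_τ + a_τ a_ξ† = ⟪ξ, τ⟫ 1`. -/
lemma create_annih_anticomm (ξ τ : L) :
    create ξ * annih τ + annih τ * create ξ = ⟪ξ, τ⟫_ℂ • (1 : Fock L →L[ℂ] Fock L) := by
  refine op_ext fun x => ?_
  simp only [add_apply, mul_apply_eq_comp, create_coe, annih_coe,
    contract_ptl_mul, smul_apply, one_apply_eq_self]
  rw [← UniformSpace.Completion.coe_add, ← UniformSpace.Completion.coe_smul, add_sub_cancel]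

/-- The canonical anticommutation relation `a_ξ† a_τ† + a_τ† a_ξ† = 0`, which is the adjoint of
`a_ξ a_τ + a_τ a_ξ = 0`. -/
lemma create_create_anticomm (ξ τ : L) : create ξ * create τ + create τ * create ξ = 0 := by
  refine op_ext fun x => ?_
  simp only [add_apply, mul_apply_eq_comp, create_coe,
    zero_apply]
  rw [← UniformSpace.Completion.coe_add, ← mul_assoc, ← mul_assoc, ptl_anticomm ξ τ, neg_mul,
    neg_add_cancel, UniformSpace.Completion.coe_zero]

end Fock

/-! ### The dynamical Lie algebra and its groups -/

section Groups

variable {L : Type*} [NormedAddCommGroup L] [InnerProductSpace ℂ L] [CompleteSpace L]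
variable {ι : Type*} (b : HilbertBasis ι ℂ L)

/-- `T` is trace class: the trace of `|T| = √(T* T)`, computed in the orthonormal basis `b`, is
finite. -/
def IsTraceClass (T : L →L[ℂ] L) : Prop :=
  Summable fun i => ⟪b i, CFC.abs T (b i)⟫_ℂ

/-- `Ξ(L)`: the anti-symmetric real linear maps `Λ : L → L` for which `Λ²` is trace class. -/
def Xi : Set (L →ₗ[ℝ] L) :=
  {Λ | (∀ ξ τ : L, ⟪ξ, Λ τ⟫_ℂ = -⟪τ, Λ ξ⟫_ℂ) ∧
    ∃ S : L →L[ℂ] L, (∀ ξ, S ξ = Λ (Λ ξ)) ∧ IsTraceClass b S}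

/-- The bounded operator `T` is the current operator
`½ ∑ᵢ (a†(bᵢ) a(ℓ bᵢ) - a(ℓ bᵢ) a†(bᵢ))` of `ℓ`, the series
converging in operator norm. (This is automatic if `ℓ` is trace class.) -/
def IsCurrent (ℓ : L →L[ℂ] L) (T : Fock L →L[ℂ] Fock L) : Prop :=
  HasSum (fun i => (1 / 2 : ℂ) •
    (create (b i) * annih (ℓ (b i)) - annih (ℓ (b i)) * create (b i))) T

/-- The bounded operator `T` is the pair annihilation operator `½ ∑ᵢ a(bᵢ) a(Λ bᵢ)` of `Λ`,
the series converging in operator norm. -/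
def IsPairAnnih (Λ : L →ₗ[ℝ] L) (T : Fock L →L[ℂ] Fock L) : Prop :=
  HasSum (fun i => (1 / 2 : ℂ) • (annih (b i) * annih (Λ (b i)))) T

/-- The Lie algebra of the current operators of trace class operators. -/
def hC : Set (Fock L →L[ℂ] Fock L) := {T | ∃ ℓ, IsTraceClass b ℓ ∧ IsCurrent b ℓ T}

/-- The pair annihilation operators. -/
def mPlus : Set (Fock L →L[ℂ] Fock L) := {T | ∃ Λ ∈ Xi b, IsPairAnnih b Λ T}

/-- The pair creation operators. -/
def mMinus : Set (Fock L →L[ℂ] Fock L) := ContinuousLinearMap.adjoint '' mPlus b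

/-- The normalized annihilation operators `a_ξ / √2`. -/
def nPlus (L : Type*) [NormedAddCommGroup L] [InnerProductSpace ℂ L] [CompleteSpace L] :
    Set (Fock L →L[ℂ] Fock L) :=
  Set.range fun ξ : L => ((1 / √2 : ℝ) : ℂ) • annih ξ

/-- The normalized creation operators `a_ξ† / √2`. -/
def nMinus (L : Type*) [NormedAddCommGroup L] [InnerProductSpace ℂ L] [CompleteSpace L] :
    Set (Fock L →L[ℂ] Fock L) :=
  ContinuousLinearMap.adjoint '' nPlus L

/-- `𝔭₊ = 𝔪₊ ⊕ 𝔫₊` -/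
def pPlus : Set (Fock L →L[ℂ] Fock L) := mPlus b + nPlus L

/-- `𝔭₋ = 𝔪₋ ⊕ 𝔫₋` -/
def pMinus : Set (Fock L →L[ℂ] Fock L) := mMinus b + nMinus L

/-- The complexified dynamical Lie algebra `𝔥 ⊕ (𝔪₊ ⊕ 𝔪₋) ⊕ (𝔫₊ ⊕ 𝔫₋)`. -/
def gC : Set (Fock L →L[ℂ] Fock L) := hC b + (mPlus b + mMinus b) + (nPlus L + nMinus L)

/-- The exponentials of `𝔭₊`. -/
def PPlus : Set (Fock L →L[ℂ] Fock L) := NormedSpace.exp '' pPlus b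

/-- The exponentials of `𝔭₋`. -/
def PMinus : Set (Fock L →L[ℂ] Fock L) := NormedSpace.exp '' pMinus b

/-- The exponentials of the current operators. -/
def HC : Set (Fock L →L[ℂ] Fock L) := NormedSpace.exp '' hC b

/-- All finite products of exponentials of elements of the Lie algebra. -/
def GAlg : Submonoid (Fock L →L[ℂ] Fock L) := Submonoid.closure (NormedSpace.exp '' gC b)

/-- The invertible operators in the operator norm closure of `GAlg`. -/
def GC : Set (Fock L →L[ℂ] Fock L) :=
  closure (GAlg b : Set (Fock L →L[ℂ] Fock L)) ∩ {g | IsUnit g}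

end Groups


end

end FermiFock

/-! Uniqueness of the factors is read off from the vacuum vector Ω. Elements of `PPlus` fix Ω,
elements of `HC` and their adjoints multiply it by nonzero scalars, so phqΩ is a multiple of pΩ.
Since ⟨Ω, pΩ⟩ = 1, the vector pΩ is determined; and p commutes with right exterior multiplications,
for which Ω is cyclic, so p is determined by pΩ. Passing to adjoints determines q, and h follows by
cancellation (`factors_unique`).

Density is proved in three steps. First, the elements whose one-parameter group lies in a closed
monoid form a closed complex subspace, by the Lie product formula. For the closed monoid generated
by exp a_ξ = 1 + a_ξ and exp a_ξ† = 1 + a_ξ†, this subspace is stable under conjugation by the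
generators, hence contains all products a_ξ a_η, a_ξ† a_η† and commutators [a_ξ, a_η†], and so all
of `gC` (`gC_subset_fieldLie`).

Second, that closed monoid lies in the closure of the products phq of exponentials of creation
operators, rank one currents and annihilation operators (`fieldMonoid_topologicalClosure_subset`).
The point is that exp a_ξ exp a_α† is itself of this form whenever 1 + ⟨α, ξ⟩ ≠ 0, and this
condition can be reached by rescaling ξ arbitrarily little.

Third, the outer factors already lie in `PMinus` and `PPlus`, as a product of exponentials of
annihilation operators is a single exponential. A product of exponentials of currents is only
approximated by such exponentials. It is determined by an invertible matrix X and a scalar k with k²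
det X = 1. If X is diagonalizable, a logarithm with the correct sign of k exists, and diagonalizable
matrices are dense (`closure_exp_dGamma_subset`). -/

namespace Matrix

/-! ### Density of diagonalizable matrices -/

open Polynomial

variable {n : Type*} [Fintype n] [DecidableEq n]

/-- A complex matrix is diagonalizable if it is similar to a diagonal matrix. -/
def IsDiagonalizable (A : Matrix n n ℂ) : Prop :=
  ∃ (Q : Matrix n n ℂ) (d : n → ℂ), IsUnit Q ∧ A = Q * diagonal d * Q⁻¹

/-- There are as many distinct eigenvalues as the size of the matrix, and eigenvectors for distinct
eigenvalues are independent, so they form the columns of an invertible matrix. -/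
theorem isDiagonalizable_of_separable {A : Matrix n n ℂ} (h : A.charpoly.Separable) :
    A.IsDiagonalizable := by
  have hcard : A.charpoly.roots.toFinset.card = Fintype.card n := by
    rw [Multiset.toFinset_card_of_nodup (nodup_roots h),
      ← (IsAlgClosed.splits A.charpoly).natDegree_eq_card_roots, charpoly_natDegree_eq_dim]
  obtain ⟨e⟩ : Nonempty (n ≃ A.charpoly.roots.toFinset) :=
    Fintype.card_eq.1 (by rw [Fintype.card_coe, hcard])
  have hev : ∀ i, ∃ v, Module.End.HasEigenvector (toLin' A) (e i : ℂ) v := by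
    intro i
    have hi : (e i : ℂ) ∈ A.charpoly.roots := Multiset.mem_toFinset.1 (e i).2
    have : Module.End.HasEigenvalue (toLin' A) (e i : ℂ) := by
      rw [Module.End.hasEigenvalue_iff_isRoot_charpoly, Matrix.charpoly_toLin']
      exact (mem_roots'.1 hi).2
    exact this.exists_hasEigenvector
  choose v hv using hev
  have hli : LinearIndependent ℂ v :=
    Module.End.eigenvectors_linearIndependent' _ (fun i => (e i : ℂ))
      (Subtype.coe_injective.comp e.injective) v hv
  have hQ : IsUnit (Matrix.of v)ᵀ := by
    rw [isUnit_transpose, ← linearIndependent_rows_iff_isUnit]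
    exact hli
  refine ⟨(Matrix.of v)ᵀ, fun i => (e i : ℂ), hQ, ?_⟩
  have key : A * (Matrix.of v)ᵀ = (Matrix.of v)ᵀ * diagonal fun i => (e i : ℂ) := by
    ext i j
    have := congrFun (hv j).apply_eq_smul i
    rw [mul_diagonal, mul_apply]
    simpa [mulVec, dotProduct, mul_comm] using this
  rw [← key, mul_nonsing_inv_cancel_right _ _ ((isUnit_iff_isUnit_det _).1 hQ)]

/-- Diagonalizable matrices are dense. -/
theorem dense_isDiagonalizable : Dense {A : Matrix n n ℂ | A.IsDiagonalizable} := by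
  intro A
  let d : n → ℂ := fun i => (Fintype.equivFin n i : ℕ)
  have hd : Function.Injective d := fun i j hij =>
    (Fintype.equivFin n).injective (Fin.ext (Nat.cast_injective hij))
  -- The complex line from `diagonal d`, whose eigenvalues are distinct, at 0 to `A` at 1.
  let M : Matrix n n ℂ[X] := (1 - X : ℂ[X]) • (diagonal d).map C + (X : ℂ[X]) • A.map C
  have hM : ∀ z : ℂ, M.map (evalRingHom z) = (1 - z) • diagonal d + z • A := by
    intro z
    ext i j
    rcases eq_or_ne i j with rfl | hij
    · simp [M]
      exact mul_comm _ _
    · simp [M, hij]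
      exact mul_comm _ _
  -- Up to normalization, the discriminant along the line. It is nonzero at 0, so it has finitely
  -- many zeros, and points with separable characteristic polynomial accumulate at 1.
  let r : ℂ[X] := resultant M.charpoly (derivative M.charpoly)
  have hr : ∀ z : ℂ, r.eval z ≠ 0 ↔ ((1 - z) • diagonal d + z • A).charpoly.Separable := by
    intro z
    have h1 : ((1 - z) • diagonal d + z • A).charpoly = M.charpoly.map (evalRingHom z) := by
      rw [← hM, charpoly_map]
    have h2 : r.eval z = resultant ((1 - z) • diagonal d + z • A).charpoly
        (derivative ((1 - z) • diagonal d + z • A).charpoly) := by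
      -- The resultant depends on the degrees assigned to its arguments, so specialization at z
      -- requires that the degrees do not drop.
      have h3 : (derivative ((1 - z) • diagonal d + z • A).charpoly).natDegree
          = (derivative M.charpoly).natDegree := by
        rw [natDegree_derivative, natDegree_derivative, charpoly_natDegree_eq_dim,
          charpoly_natDegree_eq_dim]
      rw [h3, charpoly_natDegree_eq_dim, h1, derivative_map, resultant_map_map,
        ← coe_evalRingHom]
      simp only [r, charpoly_natDegree_eq_dim]
    rw [h2, Ne, resultant_eq_zero_iff, Polynomial.Separable]
    have := (charpoly_monic ((1 - z) • diagonal d + z • A)).ne_zero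
    tauto
  have hr0 : r ≠ 0 := by
    intro h0
    refine (hr 0).2 ?_ (by rw [h0, eval_zero])
    rw [sub_zero, one_smul, zero_smul, add_zero, charpoly_diagonal]
    exact separable_prod_X_sub_C_iff.2 hd
  have hdense : Dense {z : ℂ | r.eval z ≠ 0} := by
    have : {z : ℂ | r.eval z ≠ 0} = {z | r.IsRoot z}ᶜ := rfl
    rw [this]
    exact (finite_setOfPred_isRoot hr0).countable.dense_compl ℂ
  have hc : Continuous fun z : ℂ => (1 - z) • diagonal d + z • A := by fun_prop
  have := hc.range_subset_closure_image_dense hdense (Set.mem_range_self 1)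
  rw [sub_self, zero_smul, one_smul, zero_add] at this
  refine closure_mono ?_ this
  rintro _ ⟨z, hz, rfl⟩
  exact isDiagonalizable_of_separable ((hr z).1 hz)

end Matrix

/-! ### Determinants of matrix exponentials, and perturbation to diagonalizable matrices -/

namespace Matrix

attribute [local instance] Matrix.linftyOpNormedRing Matrix.linftyOpNormedAlgebra

variable {n : Type*} [Fintype n] [DecidableEq n]

theorem exp_mul_diagonal_mul_inv {Q : Matrix n n ℂ} (hQ : IsUnit Q) (d : n → ℂ) :
    NormedSpace.exp (Q * diagonal d * Q⁻¹) = Q * diagonal (fun i => Complex.exp (d i)) * Q⁻¹ := by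
  rw [exp_conj _ _ hQ, exp_diagonal]
  congr 3
  ext i
  rw [Pi.coe_exp, Complex.exp_eq_exp_ℂ]

theorem continuous_exp : Continuous (NormedSpace.exp : Matrix n n ℂ → Matrix n n ℂ) :=
  NormedSpace.exp_continuous

/-- Jacobi's formula. -/
theorem det_exp (A : Matrix n n ℂ) : (NormedSpace.exp A).det = Complex.exp A.trace := by
  have h1 : Continuous fun A : Matrix n n ℂ => (NormedSpace.exp A).det :=
    continuous_exp.matrix_det
  have h2 : Continuous fun A : Matrix n n ℂ => Complex.exp A.trace :=
    Complex.continuous_exp.comp (continuous_id.matrix_trace)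
  refine congrFun (Continuous.ext_on dense_isDiagonalizable h1 h2 ?_) A
  rintro _ ⟨Q, d, hQ, rfl⟩
  have hQ' := (isUnit_iff_isUnit_det _).1 hQ
  simp only
  rw [exp_mul_diagonal_mul_inv hQ, det_conj hQ, det_diagonal, trace_mul_cycle,
    nonsing_inv_mul _ hQ', one_mul, trace_diagonal, Complex.exp_sum]

/-- Every invertible matrix can be made diagonalizable by multiplying it with the exponential of
a matrix near zero. -/
theorem exists_isDiagonalizable_mul_exp {A : Matrix n n ℂ} (hA : IsUnit A)
    {U : Set (Matrix n n ℂ)} (hU : U ∈ nhds 0) :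
    ∃ X ∈ U, (A * NormedSpace.exp X).IsDiagonalizable := by
  -- The derivative of exp at 0 is the identity, so the inverse function theorem makes exp open at
  -- 0.
  have h1 : NormedSpace.exp '' U ∈ nhds (1 : Matrix n n ℂ) := by
    have h := (hasStrictFDerivAt_exp_zero (𝕂 := ℂ) (𝔸 := Matrix n n ℂ)).map_nhds_eq_of_equiv
      (f' := ContinuousLinearEquiv.refl ℂ _)
    rw [NormedSpace.exp_zero] at h
    exact h.ge (Filter.image_mem_map hU)
  obtain ⟨u, rfl⟩ := hA
  have h2 : (fun B => (↑u⁻¹ : Matrix n n ℂ) * B) ⁻¹' (NormedSpace.exp '' U) ∈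
      nhds (u : Matrix n n ℂ) := by
    refine (continuous_const_mul (↑u⁻¹ : Matrix n n ℂ)).continuousAt ?_
    simpa using h1
  obtain ⟨B, hB, X, hX, hXB⟩ := dense_isDiagonalizable.inter_nhds_nonempty h2
  refine ⟨X, hX, ?_⟩
  rw [hXB]
  simpa using hB

end Matrix

/-! ### Anticommutation relations and elementary exponentials on Fock space -/

namespace FermiFock

noncomputable section

section Basic

variable {L : Type*} [NormedAddCommGroup L] [InnerProductSpace ℂ L] [CompleteSpace L]

/-- Bounded operators on Fock space. -/
abbrev Op (L : Type*) [NormedAddCommGroup L] [InnerProductSpace ℂ L] [CompleteSpace L] : Type _ :=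
  Fock L →L[ℂ] Fock L

/-! Shortcut instances. -/

scoped instance : NormedRing (Op L) := inferInstance

scoped instance : NormedAlgebra ℂ (Op L) := inferInstance

scoped instance : CompleteSpace (Op L) := inferInstance

scoped instance : Ring (Op L) := inferInstance

scoped instance : Semiring (Op L) := inferInstance

scoped instance : NonUnitalNonAssocRing (Op L) := inferInstance

scoped instance : NonUnitalNonAssocSemiring (Op L) := inferInstance

scoped instance : NonUnitalSemiring (Op L) := inferInstance

scoped instance : NonAssocSemiring (Op L) := inferInstance

scoped instance : AddCommGroup (Op L) := inferInstance

scoped instance : AddCommMonoid (Op L) := inferInstance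

scoped instance : AddGroup (Op L) := inferInstance

scoped instance : Monoid (Op L) := inferInstance

scoped instance : Semigroup (Op L) := inferInstance

scoped instance : MulOneClass (Op L) := inferInstance

scoped instance : Mul (Op L) := inferInstance

scoped instance : Add (Op L) := inferInstance

scoped instance : Sub (Op L) := inferInstance

scoped instance : Neg (Op L) := inferInstance

scoped instance : Zero (Op L) := inferInstance

scoped instance : One (Op L) := inferInstance

scoped instance : TopologicalSpace (Op L) := inferInstance

scoped instance : Module ℂ (Op L) := inferInstance

scoped instance : SMul ℂ (Op L) := inferInstance

scoped instance : MulAction ℂ (Op L) := inferInstance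

scoped instance : Algebra ℂ (Op L) := inferInstance

scoped instance : SMulCommClass ℂ (Op L) (Op L) := inferInstance

scoped instance : IsScalarTower ℂ (Op L) (Op L) := inferInstance

scoped instance : StarRing (Op L) := inferInstance

scoped instance : StarMul (Op L) := inferInstance

scoped instance : Star (Op L) := inferInstance

/-- The vacuum vector. -/
def vacuum (L : Type*) [NormedAddCommGroup L] [InnerProductSpace ℂ L] [CompleteSpace L] : Fock L :=
  ((1 : PreFock L) : Fock L)

lemma inner_vacuum_vacuum : ⟪vacuum L, vacuum L⟫_ℂ = 1 := by
  rw [vacuum, UniformSpace.Completion.inner_coe, preFock_inner, form_one_left, map_one]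

lemma vacuum_ne_zero : vacuum L ≠ 0 := fun h => by
  simpa [h] using inner_vacuum_vacuum (L := L)

lemma create_add (ξ τ : L) : create (ξ + τ) = create ξ + create τ :=
  op_ext fun x => by
    rw [add_apply, create_coe, create_coe, create_coe,
      ← UniformSpace.Completion.coe_add, ptl_add, add_mul]

lemma create_smul (c : ℂ) (ξ : L) : create (c • ξ) = starRingEnd ℂ c • create ξ :=
  op_ext fun x => by
    rw [smul_apply, create_coe, create_coe,
      ← UniformSpace.Completion.coe_smul, ptl_smul, smul_mul_assoc]

lemma norm_create_le (ξ : L) : ‖create ξ‖ ≤ ‖ξ‖ := by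
  refine ContinuousLinearMap.opNorm_le_bound _ (norm_nonneg _) fun x => ?_
  induction x using UniformSpace.Completion.induction_on with
  | hp => exact isClosed_le (by fun_prop) (by fun_prop)
  | ih x =>
    rw [create_coe, UniformSpace.Completion.norm_coe, UniformSpace.Completion.norm_coe]
    exact norm_ptl_mul_le ξ x

lemma star_create (ξ : L) : star (create ξ) = annih ξ := rfl

lemma star_annih (ξ : L) : star (annih ξ) = create ξ := by
  rw [← star_create, star_star]

lemma annih_add (ξ τ : L) : annih (ξ + τ) = annih ξ + annih τ := by
  rw [← star_create, create_add, star_add, star_create, star_create]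

lemma annih_smul (c : ℂ) (ξ : L) : annih (c • ξ) = c • annih ξ := by
  rw [← star_create, create_smul, star_smul, star_create]
  simp

lemma norm_annih_le (ξ : L) : ‖annih ξ‖ ≤ ‖ξ‖ := by
  exact (ContinuousLinearMap.adjoint.norm_map (create ξ)).trans_le (norm_create_le ξ)

/-- The annihilation operators as a continuous linear map. -/
def annihL : L →L[ℂ] Op L :=
  LinearMap.mkContinuous ⟨⟨annih, annih_add⟩, annih_smul⟩ 1 fun ξ => by
    rw [one_mul]; exact norm_annih_le ξ

@[simp] lemma annihL_apply (ξ : L) : annihL ξ = annih ξ := rfl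

/-- The creation operators as a continuous conjugate linear map. -/
def createL : L →L⋆[ℂ] Op L :=
  LinearMap.mkContinuous ⟨⟨create, create_add⟩, create_smul⟩ 1 fun ξ => by
    rw [one_mul]; exact norm_create_le ξ

@[simp] lemma createL_apply (ξ : L) : createL ξ = create ξ := rfl

lemma create_neg (ξ : L) : create (-ξ) = -create ξ := by
  rw [← createL_apply, map_neg, createL_apply]

lemma annih_neg (ξ : L) : annih (-ξ) = -annih ξ := by
  rw [← annihL_apply, map_neg, annihL_apply]

lemma annih_zero : annih (0 : L) = 0 := by
  rw [← annihL_apply, map_zero]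

lemma create_mul_create (ξ τ : L) : create ξ * create τ = -(create τ * create ξ) :=
  eq_neg_of_add_eq_zero_left (create_create_anticomm ξ τ)

lemma create_mul_self (ξ : L) : create ξ * create ξ = 0 := by
  have h := create_create_anticomm ξ ξ
  rw [← two_smul ℂ] at h
  exact (smul_eq_zero.1 h).resolve_left two_ne_zero

lemma annih_mul_annih (ξ τ : L) : annih ξ * annih τ = -(annih τ * annih ξ) := by
  have := congrArg star (create_mul_create τ ξ)
  simpa only [star_mul, star_neg, star_create] using this

lemma annih_mul_self (ξ : L) : annih ξ * annih ξ = 0 := by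
  have := congrArg star (create_mul_self ξ)
  simpa only [star_mul, star_zero, star_create] using this

lemma annih_mul_create (ξ τ : L) :
    annih ξ * create τ = ⟪τ, ξ⟫_ℂ • (1 : Op L) - create τ * annih ξ := by
  rw [← create_annih_anticomm, add_sub_cancel_left]

lemma annih_vacuum (ξ : L) : annih ξ (vacuum L) = 0 := by
  rw [vacuum, annih_coe, ← map_one (algebraMap ℂ (PreFock L)), contract_algebraMap,
    UniformSpace.Completion.coe_zero]

lemma exp_apply_of_eigenvector {E : Type*} [NormedAddCommGroup E] [NormedSpace ℂ E]
    [CompleteSpace E] {T : E →L[ℂ] E} {x : E} {c : ℂ} (h : T x = c • x) :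
    NormedSpace.exp T x = Complex.exp c • x := by
  have hn : ∀ n : ℕ, (T ^ n) x = c ^ n • x := by
    intro n
    induction n with
    | zero => simp
    | succ n ih => rw [pow_succ', mul_apply_eq_comp, ih, map_smul, h, smul_smul, pow_succ]
  have h1 := (ContinuousLinearMap.apply ℂ E x).hasSum
    (NormedSpace.exp_series_hasSum_exp' (𝕂 := ℂ) T)
  have h2 := (NormedSpace.exp_series_hasSum_exp' (𝕂 := ℂ) c).smul_const x
  rw [Complex.exp_eq_exp_ℂ]
  refine h1.unique ?_
  refine h2.congr_fun fun n => ?_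
  simp [hn, smul_smul]

lemma exp_apply_of_apply_eq_zero {E : Type*} [NormedAddCommGroup E] [NormedSpace ℂ E]
    [CompleteSpace E] {T : E →L[ℂ] E} {x : E} (h : T x = 0) : NormedSpace.exp T x = x := by
  rw [exp_apply_of_eigenvector (c := 0) (by rw [h, zero_smul]), Complex.exp_zero, one_smul]

/-- The exponential of an operator with square zero. -/
lemma exp_eq_of_sq {A : Type*} [NormedRing A] [NormedAlgebra ℂ A] [CompleteSpace A]
    {K : A} (h : K * K = 0) : NormedSpace.exp K = 1 + K := by
  have h1 := NormedSpace.exp_series_hasSum_exp' (𝕂 := ℂ) K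
  refine h1.unique ?_
  have h2 := hasSum_sum_of_ne_finset_zero (f := fun n : ℕ => ((n.factorial : ℂ)⁻¹) • K ^ n)
    (s := Finset.range 2) (L := SummationFilter.unconditional ℕ) (fun n hn => by
      obtain ⟨k, rfl⟩ : ∃ k, n = k + 2 :=
        ⟨n - 2, by have := Finset.mem_range.not.1 hn; omega⟩
      rw [pow_add, pow_two, h, mul_zero, smul_zero])
  simpa [Finset.sum_range_succ] using h2

/-- The exponential of a multiple of an operator `K` with `K² = s K`, `s ≠ 0`. -/
lemma exp_smul_eq_of_sq {A : Type*} [NormedRing A] [NormedAlgebra ℂ A] [CompleteSpace A]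
    {K : A} {s : ℂ} (hs : s ≠ 0) (h : K * K = s • K) (t : ℂ) :
    NormedSpace.exp (t • K) = 1 + ((Complex.exp (t * s) - 1) / s) • K := by
  -- Since K ^ (n + 1) = s ^ n K, the series without its constant term is that of exp (t s), divided
  -- by s and multiplied by K.
  have hn : ∀ n : ℕ, (t • K) ^ (n + 1) = ((t * s) ^ (n + 1) / s) • K := by
    intro n
    induction n with
    | zero => rw [zero_add, pow_one, pow_one, mul_div_assoc, div_self hs, mul_one]
    | succ n ih =>
      rw [pow_succ, ih, smul_mul_smul_comm, h, smul_smul]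
      congr 1
      field_simp
      ring
  have h1 := (hasSum_nat_add_iff' 1).2 (NormedSpace.exp_series_hasSum_exp' (𝕂 := ℂ) (t • K))
  have h2 := (((hasSum_nat_add_iff' 1).2
    (NormedSpace.exp_series_hasSum_exp' (𝕂 := ℂ) (t * s))).div_const s).smul_const K
  have h3 := h1.unique (h2.congr_fun fun n => by
    rw [hn, smul_smul, smul_eq_mul, mul_div_assoc])
  rw [← Complex.exp_eq_exp_ℂ] at h3
  simp only [Finset.range_one, Finset.sum_singleton, Nat.factorial_zero, Nat.cast_one, inv_one,
    pow_zero, one_smul] at h3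
  rw [← h3, add_sub_cancel]

lemma exp_mul_exp_neg_self {A : Type*} [NormedRing A] [NormedAlgebra ℂ A] [CompleteSpace A]
    (x : A) : NormedSpace.exp x * NormedSpace.exp (-x) = 1 := by
  let : NormedAlgebra ℚ A := NormedAlgebra.restrictScalars ℚ ℂ A
  rw [← NormedSpace.exp_add_of_commute (Commute.neg_right (Commute.refl x)), add_neg_cancel,
    NormedSpace.exp_zero]

lemma isUnit_exp_op (x : Op L) : IsUnit (NormedSpace.exp x) := by
  let : NormedAlgebra ℚ (Op L) := NormedAlgebra.restrictScalars ℚ ℂ (Op L)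
  exact NormedSpace.isUnit_exp x

end Basic

end

end FermiFock

/-! ### Uniqueness of the factors -/

namespace FermiFock

noncomputable section

section Injectivity

variable {L : Type*} [NormedAddCommGroup L] [InnerProductSpace ℂ L] [CompleteSpace L]

/-- The grading automorphism of the exterior algebra. -/
def grading : PreFock L →ₐ[ℂ] PreFock L :=
  CliffordAlgebra.involute (Q := (0 : QuadraticForm ℂ (StrongDual ℂ L)))

lemma grading_ptl_mul (ξ : L) (x : PreFock L) : grading (ptl ξ * x) = -(ptl ξ * grading x) := by
  have h : grading (ptl ξ) = -ptl ξ :=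
    CliffordAlgebra.involute_ι (Q := (0 : QuadraticForm ℂ (StrongDual ℂ L))) _
  rw [map_mul, h, neg_mul]

lemma contract_grading (ξ : L) (x : PreFock L) :
    contract ξ (grading x) = -grading (contract ξ x) := by
  induction x using PreFock.induction with
  | hr r => rw [AlgHom.commutes, contract_algebraMap, map_zero, neg_zero]
  | hadd x y hx hy => rw [map_add, map_add, hx, hy, map_add, map_add, neg_add]
  | hmul η x hx =>
    rw [grading_ptl_mul, map_neg, contract_ptl_mul, contract_ptl_mul, hx, map_sub, map_smul,
      grading_ptl_mul, mul_neg]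

lemma vac_grading (x : PreFock L) : vac (grading x) = vac x := by
  induction x using PreFock.induction with
  | hr r => rw [AlgHom.commutes]
  | hadd x y hx hy => rw [map_add, map_add, hx, hy, map_add]
  | hmul η x _ => rw [grading_ptl_mul, map_neg, vac_ptl_mul, vac_ptl_mul, neg_zero]

/-- The grading is the sign (-1)^degree, and only equal degrees pair nontrivially. Hence it is
isometric, and right multiplications inherit the norm bound of left multiplications. -/
lemma form_grading (x y : PreFock L) : form (grading x) (grading y) = form x y := by
  induction x using PreFock.induction generalizing y with
  | hr r => rw [AlgHom.commutes, form_algebraMap_left, form_algebraMap_left, vac_grading]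
  | hadd x x' hx hx' => rw [map_add, form_add_left, form_add_left, hx, hx']
  | hmul η x hx =>
    rw [grading_ptl_mul, ← neg_one_smul ℂ (ptl η * grading x), form_smul_left,
      form_ptl_mul_left, contract_grading, ← neg_one_smul ℂ (grading (contract η y)),
      form_smul_right, hx, form_ptl_mul_left]
    simp

lemma mul_ptl (ξ : L) (x : PreFock L) : x * ptl ξ = ptl ξ * grading x := by
  induction x using PreFock.induction with
  | hr r => rw [AlgHom.commutes, Algebra.commutes]
  | hadd x y hx hy => rw [add_mul, hx, hy, map_add, mul_add]
  | hmul η x hx =>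
    rw [grading_ptl_mul, mul_neg, ← mul_assoc, ptl_anticomm, neg_mul, neg_neg, mul_assoc, hx,
      ← mul_assoc]

lemma norm_mul_ptl_le (ξ : L) (x : PreFock L) : ‖x * ptl ξ‖ ≤ ‖ξ‖ * ‖x‖ := by
  have h : ‖grading x‖ = ‖x‖ := by
    have h1 : ‖grading x‖ ^ 2 = (form (grading x) (grading x)).re :=
      norm_sq_eq_re_inner (𝕜 := ℂ) _
    have h2 : ‖x‖ ^ 2 = (form x x).re := norm_sq_eq_re_inner (𝕜 := ℂ) _
    rw [form_grading, ← h2] at h1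
    exact (sq_eq_sq₀ (norm_nonneg _) (norm_nonneg _)).1 h1
  rw [mul_ptl, ← h]
  exact norm_ptl_mul_le ξ _

/-- Exterior multiplication by `⟪ξ, ·⟫` from the right. -/
def rightMul (ξ : L) : Op L :=
  (LinearMap.mkContinuous (LinearMap.mulRight ℂ (ptl ξ)) ‖ξ‖ (norm_mul_ptl_le ξ)).completion

lemma rightMul_coe (ξ : L) (x : PreFock L) :
    rightMul ξ (x : Fock L) = ((x * ptl ξ : PreFock L) : Fock L) :=
  UniformSpace.Completion.map_coe (ContinuousLinearMap.uniformContinuous _) x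

/-- This is associativity of the exterior product. It places all of `PMinus` in the commutant of the
right multiplications. -/
lemma commute_create_rightMul (ξ η : L) : Commute (create ξ) (rightMul η) :=
  op_ext fun x => by
    rw [mul_apply_eq_comp, mul_apply_eq_comp, create_coe, rightMul_coe, rightMul_coe, create_coe,
      mul_assoc]

lemma PreFock.right_induction {P : PreFock L → Prop} (hr : ∀ r : ℂ, P (algebraMap ℂ _ r))
    (hadd : ∀ x y, P x → P y → P (x + y)) (hmul : ∀ ξ x, P x → P (x * ptl ξ))
    (x : PreFock L) : P x := by
  refine CliffordAlgebra.right_induction (Q := (0 : QuadraticForm ℂ (StrongDual ℂ L)))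
    (P := P) hr hadd (fun m x hx => ?_) x
  have := hmul ((InnerProductSpace.toDual ℂ L).symm m) x hx
  rw [ptl, LinearIsometryEquiv.apply_symm_apply] at this
  exact this

lemma coe_algebraMap (r : ℂ) :
    ((algebraMap ℂ (PreFock L) r : PreFock L) : Fock L) = r • vacuum L := by
  rw [Algebra.algebraMap_eq_smul_one, UniformSpace.Completion.coe_smul, vacuum]

/-- An operator commuting with the right multiplications is determined by its value at the
vacuum. -/
lemma eq_of_commute_rightMul {S T : Op L} (hS : ∀ ξ, Commute S (rightMul ξ))
    (hT : ∀ ξ, Commute T (rightMul ξ)) (h : S (vacuum L) = T (vacuum L)) : S = T := by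
  refine op_ext fun x => ?_
  induction x using PreFock.right_induction with
  | hr r => rw [coe_algebraMap, map_smul, map_smul, h]
  | hadd x y hx hy => rw [UniformSpace.Completion.coe_add, map_add, map_add, hx, hy]
  | hmul ξ x hx =>
    rw [← rightMul_coe, ← mul_apply_eq_comp, ← mul_apply_eq_comp, hS ξ, hT ξ,
      mul_apply_eq_comp, mul_apply_eq_comp, hx]

lemma _root_.HasSum.commute {A κ : Type*} [Ring A] [TopologicalSpace A] [IsTopologicalRing A]
    [T2Space A] {f : κ → A} {a c : A} (hf : HasSum f a) (h : ∀ i, Commute (f i) c) :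
    Commute a c :=
  (hf.mul_right c).unique <| by
    simpa only [fun i => (h i).eq] using hf.mul_left c

variable {ι : Type*} {b : HilbertBasis ι ℂ L}

lemma commute_rightMul_of_mem_pMinus {T : Op L} (hT : T ∈ pMinus b) (ξ : L) :
    Commute T (rightMul ξ) := by
  obtain ⟨_, ⟨T, ⟨Λ, _, hΛ⟩, rfl⟩, _, ⟨_, ⟨η, rfl⟩, rfl⟩, rfl⟩ := hT
  refine Commute.add_left ?_ ?_
  · refine HasSum.commute (hΛ.star) fun i => ?_
    rw [star_smul, star_mul, star_annih, star_annih]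
    exact ((commute_create_rightMul (Λ (b i)) ξ).mul_left
      (commute_create_rightMul (b i) ξ)).smul_left _
  · change Commute (star (_ • annih η)) _
    rw [star_smul, star_annih]
    exact (commute_create_rightMul η ξ).smul_left _

lemma commute_rightMul_of_mem_PMinus {p : Op L} (hp : p ∈ PMinus b) (ξ : L) :
    Commute p (rightMul ξ) := by
  obtain ⟨T, hT, rfl⟩ := hp
  exact (commute_rightMul_of_mem_pMinus hT ξ).exp_left

/-- Every term of the series has an annihilation operator as its rightmost factor. -/
lemma apply_vacuum_of_mem_pPlus {T : Op L} (hT : T ∈ pPlus b) : T (vacuum L) = 0 := by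
  obtain ⟨T, ⟨Λ, _, hΛ⟩, _, ⟨η, rfl⟩, rfl⟩ := hT
  have h1 : T (vacuum L) = 0 := by
    have := (ContinuousLinearMap.apply ℂ (Fock L) (vacuum L)).hasSum hΛ
    refine this.unique ?_
    simp [annih_vacuum]
  rw [add_apply, h1, smul_apply, annih_vacuum, smul_zero, add_zero]

lemma apply_vacuum_of_mem_PPlus {q : Op L} (hq : q ∈ PPlus b) : q (vacuum L) = vacuum L := by
  obtain ⟨T, hT, rfl⟩ := hq
  exact exp_apply_of_apply_eq_zero (apply_vacuum_of_mem_pPlus hT)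

lemma star_mem_pPlus {T : Op L} (hT : T ∈ pMinus b) : star T ∈ pPlus b := by
  obtain ⟨_, ⟨S, hS, rfl⟩, _, ⟨R, hR, rfl⟩, rfl⟩ := hT
  refine ⟨S, hS, R, hR, ?_⟩
  change S + R = star (star S + star R)
  rw [star_add, star_star, star_star]

lemma star_mem_pMinus {T : Op L} (hT : T ∈ pPlus b) : star T ∈ pMinus b := by
  obtain ⟨S, hS, R, hR, rfl⟩ := hT
  exact ⟨_, ⟨S, hS, rfl⟩, _, ⟨R, hR, rfl⟩, (star_add S R).symm⟩

lemma star_mem_PPlus {p : Op L} (hp : p ∈ PMinus b) : star p ∈ PPlus b := by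
  obtain ⟨T, hT, rfl⟩ := hp
  exact ⟨star T, star_mem_pPlus hT, (NormedSpace.star_exp T).symm⟩

lemma star_mem_PMinus {q : Op L} (hq : q ∈ PPlus b) : star q ∈ PMinus b := by
  obtain ⟨T, hT, rfl⟩ := hq
  exact ⟨star T, star_mem_pMinus hT, (NormedSpace.star_exp T).symm⟩

lemma inner_vacuum_of_mem_PMinus {p : Op L} (hp : p ∈ PMinus b) :
    ⟪vacuum L, p (vacuum L)⟫_ℂ = 1 := by
  rw [← ContinuousLinearMap.adjoint_inner_left]
  have h : ContinuousLinearMap.adjoint p (vacuum L) = vacuum L :=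
    apply_vacuum_of_mem_PPlus (star_mem_PPlus hp)
  rw [h, inner_vacuum_vacuum]

/-- If `x` is an eigenvector of all the terms of a convergent series of operators, then it is an
eigenvector of its sum. -/
lemma exists_eigenvalue_of_hasSum {E κ : Type*} [NormedAddCommGroup E] [NormedSpace ℂ E]
    [CompleteSpace E] {f : κ → E →L[ℂ] E} {T : E →L[ℂ] E} (hf : HasSum f T) {x : E}
    (h : ∀ i, ∃ c : ℂ, f i x = c • x) : ∃ c : ℂ, T x = c • x := by
  -- The line through x is finite dimensional, hence closed, so the limit stays on it and the
  -- eigenvalue need not be computed.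
  have hx : T x ∈ Submodule.span ℂ {x} := by
    have hc : IsClosed (Submodule.span ℂ {x} : Set E) := Submodule.closed_of_finiteDimensional _
    have := (ContinuousLinearMap.apply ℂ E x).hasSum hf
    refine hc.mem_of_tendsto this (Filter.Eventually.of_forall fun s => ?_)
    refine Submodule.sum_mem _ fun i _ => ?_
    obtain ⟨c, hc⟩ := h i
    exact Submodule.mem_span_singleton.2 ⟨c, hc.symm⟩
  obtain ⟨c, hc⟩ := Submodule.mem_span_singleton.1 hx
  exact ⟨c, hc.symm⟩

/-- Each term of the series multiplies the vacuum by a scalar, by the anticommutation relation. The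
adjoint of a term has the same shape with its two vectors exchanged. -/
lemma exists_eigenvalue_of_mem_hC {T : Op L} (hT : T ∈ hC b) :
    (∃ c : ℂ, T (vacuum L) = c • vacuum L) ∧ ∃ c : ℂ, star T (vacuum L) = c • vacuum L := by
  obtain ⟨ℓ, _, h⟩ := hT
  have key : ∀ ξ τ : L, ∃ c : ℂ, ((1 / 2 : ℂ) • (create ξ * annih τ - annih τ * create ξ))
      (vacuum L) = c • vacuum L := by
    intro ξ τ
    refine ⟨-(1 / 2 * ⟪ξ, τ⟫_ℂ), ?_⟩
    rw [annih_mul_create, smul_apply, sub_apply, sub_apply, mul_apply_eq_comp, annih_vacuum,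
      map_zero, smul_apply, one_apply_eq_self, sub_zero, zero_sub, smul_neg, smul_smul, neg_smul]
  refine ⟨exists_eigenvalue_of_hasSum h fun i => key _ _,
    exists_eigenvalue_of_hasSum h.star fun i => ?_⟩
  rw [star_smul, star_sub, star_mul, star_mul, star_annih, star_create]
  simpa using key (ℓ (b i)) (b i)

lemma exists_eigenvalue_of_mem_HC {h : Op L} (hh : h ∈ HC b) :
    (∃ c : ℂ, c ≠ 0 ∧ h (vacuum L) = c • vacuum L) ∧
      ∃ c : ℂ, c ≠ 0 ∧ star h (vacuum L) = c • vacuum L := by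
  obtain ⟨T, hT, rfl⟩ := hh
  obtain ⟨⟨c, hc⟩, c', hc'⟩ := exists_eigenvalue_of_mem_hC hT
  refine ⟨⟨_, Complex.exp_ne_zero c, exp_apply_of_eigenvector hc⟩,
    _, Complex.exp_ne_zero c', ?_⟩
  rw [NormedSpace.star_exp]
  exact exp_apply_of_eigenvector hc'

/-- Pairing with the vacuum, where both p and p' give 1, yields c = c'. Then p and p' agree on the
vacuum, which is cyclic for the right multiplications. -/
lemma PMinus_eq_of_apply_vacuum {p p' : Op L} (hp : p ∈ PMinus b) (hp' : p' ∈ PMinus b)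
    {c c' : ℂ} (hc : c ≠ 0) (h : c • p (vacuum L) = c' • p' (vacuum L)) : p = p' := by
  have h1 := congrArg (fun x => ⟪vacuum L, x⟫_ℂ) h
  simp only [inner_smul_right, inner_vacuum_of_mem_PMinus hp, inner_vacuum_of_mem_PMinus hp',
    mul_one] at h1
  subst h1
  exact eq_of_commute_rightMul (commute_rightMul_of_mem_PMinus hp)
    (commute_rightMul_of_mem_PMinus hp') (smul_right_injective _ hc h)

lemma isUnit_of_mem_PMinus {p : Op L} (hp : p ∈ PMinus b) : IsUnit p := by
  obtain ⟨T, _, rfl⟩ := hp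
  exact isUnit_exp_op T

lemma isUnit_of_mem_HC {p : Op L} (hp : p ∈ HC b) : IsUnit p := by
  obtain ⟨T, _, rfl⟩ := hp
  exact isUnit_exp_op T

lemma isUnit_of_mem_PPlus {p : Op L} (hp : p ∈ PPlus b) : IsUnit p := by
  obtain ⟨T, _, rfl⟩ := hp
  exact isUnit_exp_op T

/-- Applied to the vacuum, q disappears and h contributes a nonzero scalar. Only this effect of h is
assumed, so that the lemma also applies to adjoints. -/
lemma factor_left_unique {p p' h h' q q' : Op L} (hp : p ∈ PMinus b) (hp' : p' ∈ PMinus b)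
    (hh : ∃ c : ℂ, c ≠ 0 ∧ h (vacuum L) = c • vacuum L)
    (hh' : ∃ c : ℂ, c ≠ 0 ∧ h' (vacuum L) = c • vacuum L)
    (hq : q ∈ PPlus b) (hq' : q' ∈ PPlus b) (e : p * h * q = p' * h' * q') : p = p' := by
  obtain ⟨c, hc, hcv⟩ := hh
  obtain ⟨c', _, hcv'⟩ := hh'
  have := congrArg (fun T : Op L => T (vacuum L)) e
  simp only [mul_apply_eq_comp, apply_vacuum_of_mem_PPlus hq, apply_vacuum_of_mem_PPlus hq',
    hcv, hcv', map_smul] at this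
  exact PMinus_eq_of_apply_vacuum hp hp' hc this

/-- The factors of `p h q` are determined by the product. -/
theorem factors_unique {p p' h h' q q' : Op L} (hp : p ∈ PMinus b) (hp' : p' ∈ PMinus b)
    (hh : h ∈ HC b) (hh' : h' ∈ HC b) (hq : q ∈ PPlus b) (hq' : q' ∈ PPlus b)
    (e : p * h * q = p' * h' * q') : p = p' ∧ h = h' ∧ q = q' := by
  have h1 : p = p' := factor_left_unique hp hp' (exists_eigenvalue_of_mem_HC hh).1
    (exists_eigenvalue_of_mem_HC hh').1 hq hq' e
  -- The adjoint of phq is q† h† p†, whose left factor q† lies in `PMinus`.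
  have h2 : star q = star q' := by
    refine factor_left_unique (star_mem_PMinus hq) (star_mem_PMinus hq')
      (exists_eigenvalue_of_mem_HC hh).2 (exists_eigenvalue_of_mem_HC hh').2
      (star_mem_PPlus hp) (star_mem_PPlus hp') ?_
    simpa only [star_mul, mul_assoc] using congrArg star e
  obtain rfl := h1
  obtain rfl := star_injective h2
  exact ⟨rfl, (isUnit_of_mem_PMinus hp).mul_left_cancel
    ((isUnit_of_mem_PPlus hq).mul_right_cancel e), rfl⟩

end Injectivity

end

end FermiFock

/-! ### Finite rank elements of the Lie algebra, and products of exponentials of annihilation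
operators -/

namespace FermiFock

noncomputable section

section FiniteRank

variable {L : Type*} [NormedAddCommGroup L] [InnerProductSpace ℂ L]
variable {ι : Type*} (b : HilbertBasis ι ℂ L)

/-- Finite dimensional projections are Hilbert–Schmidt: expanding in an orthonormal basis of W
reduces the claim to Parseval for each basis vector. -/
lemma summable_norm_starProjection_sq (W : Submodule ℂ L) [FiniteDimensional ℂ W] :
    Summable fun i => ‖W.starProjection (b i)‖ ^ 2 := by
  let e := stdOrthonormalBasis ℂ W
  have h : ∀ i, ‖W.starProjection (b i)‖ ^ 2 = ∑ k, ‖⟪(e k : L), b i⟫_ℂ‖ ^ 2 := by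
    intro i
    rw [Submodule.starProjection_apply, Submodule.norm_coe, ← e.sum_sq_norm_inner_right]
    refine Finset.sum_congr rfl fun k _ => ?_
    rw [← Submodule.inner_orthogonalProjectionOnto_eq_of_mem_left]
  simp_rw [h]
  refine summable_sum fun k _ => ?_
  have := (b.summable_inner_mul_inner (e k : L) (e k : L)).norm
  refine this.congr fun i => ?_
  rw [norm_mul, norm_inner_symm, sq, norm_inner_symm]

lemma hasSum_inner_smul (b : HilbertBasis ι ℂ L) (x : L) :
    HasSum (fun i => ⟪b i, x⟫_ℂ • b i) x := by
  simpa only [b.repr_apply_apply] using b.hasSum_repr x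

variable [CompleteSpace L] {b}

/-- Operators of finite rank are trace class. -/
lemma isTraceClass_of_finiteDimensional {S : L →L[ℂ] L} (W : Submodule ℂ L)
    [FiniteDimensional ℂ W] (h : ∀ x ∈ Wᗮ, S x = 0) : IsTraceClass b S := by
  have hs : star (CFC.abs S) = CFC.abs S := (CFC.abs_nonneg S).star_eq
  have hi : ∀ x y, ⟪CFC.abs S x, y⟫_ℂ = ⟪x, CFC.abs S y⟫_ℂ := fun x y => by
    rw [← ContinuousLinearMap.adjoint_inner_right, ← ContinuousLinearMap.star_eq_adjoint, hs]
  -- The kernel of S lies in that of |S|, because |S|² = S†S.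
  have h0 : ∀ x, S x = 0 → CFC.abs S x = 0 := by
    intro x hx
    rw [← inner_self_eq_zero (𝕜 := ℂ), hi, ← mul_apply_eq_comp, CFC.abs_mul_abs,
      mul_apply_eq_comp, hx, map_zero, inner_zero_right]
  have hP : ∀ x, CFC.abs S x = CFC.abs S (W.starProjection x) := fun x => by
    rw [← sub_eq_zero, ← map_sub]
    exact h0 _ (h _ (W.sub_starProjection_mem_orthogonal x))
  -- With P the projection onto W, |S| = |S|P and self-adjointness give |S| = P|S|P, so the diagonal
  -- entries are at most ‖|S|‖ ‖P bᵢ‖².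
  refine Summable.of_norm_bounded (g := fun i => ‖CFC.abs S‖ * ‖W.starProjection (b i)‖ ^ 2)
    ((summable_norm_starProjection_sq b W).mul_left _) fun i => ?_
  rw [hP, ← hi, hP, hi]
  calc _ ≤ ‖W.starProjection (b i)‖ * ‖CFC.abs S (W.starProjection (b i))‖ := norm_inner_le_norm _ _
    _ ≤ ‖W.starProjection (b i)‖ * (‖CFC.abs S‖ * ‖W.starProjection (b i)‖) := by
      gcongr
      exact ContinuousLinearMap.le_opNorm _ _
    _ = _ := by ring

lemma hasSum_create (b : HilbertBasis ι ℂ L) (x : L) :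
    HasSum (fun i => ⟪x, b i⟫_ℂ • create (b i)) (create x) := by
  have := createL.hasSum (hasSum_inner_smul b x)
  simpa [Function.comp_def] using this

lemma hasSum_annih (b : HilbertBasis ι ℂ L) (x : L) :
    HasSum (fun i => ⟪b i, x⟫_ℂ • annih (b i)) (annih x) := by
  have := annihL.hasSum (hasSum_inner_smul b x)
  simpa [Function.comp_def] using this

variable (b) in
/-- The current operators of operators of finite rank. -/
def finiteCurrents : Submodule ℂ (Op L) where
  carrier := {T | ∃ (ℓ : L →L[ℂ] L) (W : Submodule ℂ L), FiniteDimensional ℂ W ∧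
    (∀ x ∈ Wᗮ, ℓ x = 0) ∧ IsCurrent b ℓ T}
  zero_mem' := ⟨0, ⊥, inferInstance, fun _ _ => rfl, by
    simp [IsCurrent, annih_zero]⟩
  add_mem' := by
    rintro S T ⟨ℓ, W, hW, h0, h⟩ ⟨ℓ', W', hW', h0', h'⟩
    refine ⟨ℓ + ℓ', W ⊔ W', inferInstance, fun x hx => ?_, (h.add h').congr_fun fun i => ?_⟩
    · rw [add_apply, h0 _ (Submodule.orthogonal_le le_sup_left hx),
        h0' _ (Submodule.orthogonal_le le_sup_right hx), add_zero]
    · rw [add_apply, annih_add, mul_add, add_mul, ← smul_add]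
      abel_nf
  smul_mem' := by
    rintro c T ⟨ℓ, W, hW, h0, h⟩
    refine ⟨c • ℓ, W, hW, fun x hx => ?_, (h.const_smul c).congr_fun fun i => ?_⟩
    · rw [smul_apply, h0 x hx, smul_zero]
    · rw [smul_apply, annih_smul, mul_smul_comm, smul_mul_assoc, ← smul_sub, smul_comm]

lemma finiteCurrents_subset_hC : (finiteCurrents b : Set (Op L)) ⊆ hC b := by
  rintro T ⟨ℓ, W, hW, h0, h⟩
  exact ⟨ℓ, isTraceClass_of_finiteDimensional W h0, h⟩

/-- This is the current of η ↦ ⟨α, η⟩ ξ: the series sums to a_α† a_ξ, and reordering its second half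
subtracts half the trace ⟨α, ξ⟩. -/
lemma create_mul_annih_mem_finiteCurrents (α ξ : L) :
    create α * annih ξ - (1 / 2 * ⟪α, ξ⟫_ℂ) • (1 : Op L) ∈ finiteCurrents b := by
  refine ⟨(innerSL ℂ α).smulRight ξ, Submodule.span ℂ {α}, inferInstance, fun x hx => ?_, ?_⟩
  · rw [ContinuousLinearMap.smulRight_apply, innerSL_apply_apply,
      Submodule.mem_orthogonal_singleton_iff_inner_right.1 hx, zero_smul]
  · have h1 := (hasSum_create b α).mul_right (annih ξ)
    have h2 := ((b.hasSum_inner_mul_inner α ξ).mul_left (1 / 2)).smul_const (1 : Op L)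
    refine (h1.sub h2).congr_fun fun i => ?_
    rw [ContinuousLinearMap.smulRight_apply, innerSL_apply_apply, annih_smul, smul_mul_assoc,
      annih_mul_create, mul_smul_comm, smul_mul_assoc]
    module

/-- A conjugate linear operator, as a real linear map. -/
def conjToReal (Λ : L →L⋆[ℂ] L) : L →ₗ[ℝ] L where
  toFun := Λ
  map_add' := map_add Λ
  map_smul' r x := by
    rw [RCLike.real_smul_eq_coe_smul (K := ℂ), map_smulₛₗ, RCLike.conj_ofReal,
      ← RCLike.real_smul_eq_coe_smul]
    rfl

variable (b) in
/-- The pair annihilation operators of anti-symmetric operators of finite rank. -/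
def finitePairs : Submodule ℂ (Op L) where
  carrier := {T | ∃ (Λ : L →L⋆[ℂ] L) (W : Submodule ℂ L), FiniteDimensional ℂ W ∧
    (∀ x ∈ Wᗮ, Λ x = 0) ∧ (∀ ξ τ, ⟪ξ, Λ τ⟫_ℂ = -⟪τ, Λ ξ⟫_ℂ) ∧ IsPairAnnih b (conjToReal Λ) T}
  zero_mem' := ⟨0, ⊥, inferInstance, fun _ _ => rfl, by simp, by
    simp [IsPairAnnih, conjToReal, annih_zero]⟩
  add_mem' := by
    rintro S T ⟨Λ, W, hW, h0, ha, h⟩ ⟨Λ', W', hW', h0', ha', h'⟩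
    refine ⟨Λ + Λ', W ⊔ W', inferInstance, fun x hx => ?_, fun ξ τ => ?_,
      (h.add h').congr_fun fun i => ?_⟩
    · rw [add_apply, h0 _ (Submodule.orthogonal_le le_sup_left hx),
        h0' _ (Submodule.orthogonal_le le_sup_right hx), add_zero]
    · rw [add_apply, add_apply, inner_add_right, inner_add_right, ha, ha', neg_add]
    · rw [← smul_add, ← mul_add, ← annih_add]
      rfl
  smul_mem' := by
    rintro c T ⟨Λ, W, hW, h0, ha, h⟩
    refine ⟨c • Λ, W, hW, fun x hx => ?_, fun ξ τ => ?_, (h.const_smul c).congr_fun fun i => ?_⟩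
    · rw [smul_apply, h0 x hx, smul_zero]
    · rw [smul_apply, smul_apply, inner_smul_right, inner_smul_right, ha, mul_neg]
    · change (1 / 2 : ℂ) • (annih (b i) * annih (c • Λ (b i))) =
        c • (1 / 2 : ℂ) • (annih (b i) * annih (Λ (b i)))
      rw [annih_smul, mul_smul_comm, smul_comm]

lemma finitePairs_subset_mPlus : (finitePairs b : Set (Op L)) ⊆ mPlus b := by
  rintro T ⟨Λ, W, hW, h0, ha, h⟩
  refine ⟨conjToReal Λ, ⟨ha, Λ.comp Λ, fun _ => rfl, ?_⟩, h⟩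
  refine isTraceClass_of_finiteDimensional W fun x hx => ?_
  rw [ContinuousLinearMap.comp_apply, h0 x hx, map_zero]

lemma annih_mul_annih_mem_finitePairs (u v : L) : annih u * annih v ∈ finitePairs b := by
  -- The map η ↦ ⟨η, u⟩ v - ⟨η, v⟩ u. Its series gives half of a_u a_v - a_v a_u, which is a_u a_v.
  refine ⟨(ContinuousLinearMap.toSpanSingleton ℂ v).comp (innerSLFlip ℂ u) -
    (ContinuousLinearMap.toSpanSingleton ℂ u).comp (innerSLFlip ℂ v),
    Submodule.span ℂ {u, v}, FiniteDimensional.span_of_finite ℂ (by simp), fun x hx => ?_,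
    fun ξ τ => ?_, ?_⟩
  · have h1 : ⟪x, u⟫_ℂ = 0 := Submodule.inner_left_of_mem_orthogonal
      (Submodule.subset_span (by simp)) hx
    have h2 : ⟪x, v⟫_ℂ = 0 := Submodule.inner_left_of_mem_orthogonal
      (Submodule.subset_span (by simp)) hx
    simp [h1, h2]
  · simp
    ring
  · have h1 := (hasSum_annih b u).mul_right (annih v)
    have h2 := (hasSum_annih b v).mul_right (annih u)
    have h3 := (h1.sub h2).const_smul (1 / 2 : ℂ)
    rw [annih_mul_annih v u, sub_neg_eq_add, ← two_smul ℂ, smul_smul, one_div,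
      inv_mul_cancel₀ two_ne_zero, one_smul] at h3
    refine h3.congr_fun fun i => ?_
    change (1 / 2 : ℂ) • (annih (b i) * annih (⟪b i, u⟫_ℂ • v - ⟪b i, v⟫_ℂ • u)) = _
    rw [sub_eq_add_neg, annih_add, annih_neg, annih_smul, annih_smul, mul_add, mul_neg,
      mul_smul_comm, mul_smul_comm, smul_mul_assoc, smul_mul_assoc, one_div, sub_eq_add_neg]

variable (L) in
/-- The monoid generated by the exponentials `1 + a_ξ` of annihilation operators. -/
def annihMonoid : Submonoid (Op L) := Submonoid.closure (Set.range fun ξ : L => 1 + annih ξ)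

variable (L) in
/-- The monoid generated by the exponentials `1 + a_ξ†` of creation operators. -/
def createMonoid : Submonoid (Op L) := Submonoid.closure (Set.range fun ξ : L => 1 + create ξ)

lemma annih_mem_nPlus (ξ : L) : annih ξ ∈ nPlus L := by
  refine ⟨((√2 : ℝ) : ℂ) • ξ, ?_⟩
  simp only
  rw [annih_smul, smul_smul, ← Complex.ofReal_mul, one_div,
    inv_mul_cancel₀ (by positivity), Complex.ofReal_one, one_smul]

lemma commute_annih_of_mem_finitePairs {m : Op L} (hm : m ∈ finitePairs b) (ξ : L) :
    Commute m (annih ξ) := by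
  obtain ⟨Λ, W, _, _, _, h⟩ := hm
  refine HasSum.commute h fun i => Commute.smul_left ?_ _
  rw [Commute, SemiconjBy, mul_assoc, annih_mul_annih _ ξ, mul_neg, ← mul_assoc,
    annih_mul_annih _ ξ, neg_mul, neg_neg, mul_assoc]

/-- The Baker–Campbell–Hausdorff formula: half the commutator of a_ξ and a_η is a_ξ a_η, which
commutes with all annihilation operators. -/
lemma one_add_annih_mul (ξ η : L) :
    (1 + annih ξ) * (1 + annih η) = (1 + annih (ξ + η)) * (1 + annih ξ * annih η) := by
  have h1 : annih ξ * (annih ξ * annih η) = 0 := by rw [← mul_assoc, annih_mul_self, zero_mul]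
  have h2 : annih η * (annih ξ * annih η) = 0 := by
    rw [annih_mul_annih ξ, mul_neg, ← mul_assoc, annih_mul_self, zero_mul, neg_zero]
  rw [annih_add]
  simp only [mul_add, add_mul, one_mul, mul_one, h1, h2]
  abel

lemma exp_annih (ξ : L) : NormedSpace.exp (annih ξ) = 1 + annih ξ :=
  exp_eq_of_sq (annih_mul_self ξ)

lemma exp_create (ξ : L) : NormedSpace.exp (create ξ) = 1 + create ξ :=
  exp_eq_of_sq (create_mul_self ξ)

/-- Pair operators commute with annihilation operators, so the correction terms from multiplying
exponentials of annihilation operators collect in one exponential. -/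
lemma exists_of_mem_annihMonoid (b : HilbertBasis ι ℂ L) {q : Op L} (hq : q ∈ annihMonoid L) :
    ∃ m ∈ finitePairs b, ∃ ξ, q = (1 + annih ξ) * NormedSpace.exp m := by
  let : NormedAlgebra ℚ (Op L) := NormedAlgebra.restrictScalars ℚ ℂ (Op L)
  induction hq using Submonoid.closure_induction_left with
  | one => exact ⟨0, zero_mem _, 0, by rw [annih_zero, NormedSpace.exp_zero, add_zero, mul_one]⟩
  | mul_left x hx y _ ih =>
    obtain ⟨ξ, rfl⟩ := hx
    obtain ⟨m, hm, η, rfl⟩ := ih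
    refine ⟨annih ξ * annih η + m, add_mem (annih_mul_annih_mem_finitePairs ξ η) hm, ξ + η, ?_⟩
    have hc : Commute (annih ξ * annih η) m :=
      ((commute_annih_of_mem_finitePairs hm ξ).mul_right
        (commute_annih_of_mem_finitePairs hm η)).symm
    have hsq : annih ξ * annih η * (annih ξ * annih η) = 0 := by
      rw [annih_mul_annih ξ η, neg_mul_neg, mul_assoc, ← mul_assoc (annih ξ), annih_mul_annih ξ η,
        neg_mul, mul_assoc, annih_mul_self, mul_zero, neg_zero, mul_zero]
    rw [NormedSpace.exp_add_of_commute hc, exp_eq_of_sq hsq, ← mul_assoc, ← mul_assoc]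
    simp only
    rw [one_add_annih_mul]

lemma annihMonoid_subset_PPlus : (annihMonoid L : Set (Op L)) ⊆ PPlus b := by
  intro q hq
  let : NormedAlgebra ℚ (Op L) := NormedAlgebra.restrictScalars ℚ ℂ (Op L)
  obtain ⟨m, hm, ξ, rfl⟩ := exists_of_mem_annihMonoid b hq
  refine ⟨m + annih ξ, ⟨m, finitePairs_subset_mPlus hm, _, annih_mem_nPlus ξ, rfl⟩, ?_⟩
  rw [add_comm, NormedSpace.exp_add_of_commute (commute_annih_of_mem_finitePairs hm ξ).symm,
    exp_annih]

lemma star_mem_annihMonoid {p : Op L} (hp : p ∈ createMonoid L) : star p ∈ annihMonoid L := by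
  induction hp using Submonoid.closure_induction with
  | mem x hx =>
    obtain ⟨ξ, rfl⟩ := hx
    refine Submonoid.subset_closure ⟨ξ, ?_⟩
    simp only
    rw [star_add, star_one, star_create]
  | one => rw [star_one]; exact one_mem _
  | mul x y _ _ hx hy => rw [star_mul]; exact mul_mem hy hx

lemma createMonoid_subset_PMinus : (createMonoid L : Set (Op L)) ⊆ PMinus b := by
  intro p hp
  rw [← star_star p]
  exact star_mem_PMinus (annihMonoid_subset_PPlus (star_mem_annihMonoid hp))

end FiniteRank

end

end FermiFock

/-! ### The big cell and its closure -/

namespace FermiFock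

noncomputable section

section BigCell

variable {L : Type*} [NormedAddCommGroup L] [InnerProductSpace ℂ L] [CompleteSpace L]

/-- The current operator of the operator `η ↦ ⟪α, η⟫ ξ`. -/
def rankOneCurrent (α ξ : L) : Op L := create α * annih ξ - (1 / 2 * ⟪α, ξ⟫_ℂ) • (1 : Op L)

variable (L) in
/-- The monoid generated by the exponentials of current operators of operators of rank one. -/
def currentMonoid : Submonoid (Op L) := Submonoid.closure
  {h | ∃ (t : ℂ) (α ξ : L), h = NormedSpace.exp (t • rankOneCurrent α ξ)}

/-- Thus a_α† a_ξ is nilpotent or a multiple of an idempotent, according to whether ⟨α, ξ⟩ vanishes,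
and its exponentials have a closed form. -/
lemma create_annih_mul_self (α ξ : L) :
    create α * annih ξ * (create α * annih ξ) = ⟪α, ξ⟫_ℂ • (create α * annih ξ) := by
  rw [mul_assoc, ← mul_assoc (annih ξ), annih_mul_create, sub_mul, mul_sub, mul_assoc (create α),
    annih_mul_self, mul_zero, mul_zero, sub_zero, smul_mul_assoc, one_mul, mul_smul_comm]

lemma exp_smul_one (t : ℂ) : NormedSpace.exp (t • (1 : Op L)) = Complex.exp t • (1 : Op L) := by
  rw [exp_smul_eq_of_sq one_ne_zero (by rw [mul_one, one_smul]), mul_one, div_one, sub_smul,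
    one_smul, add_sub_cancel]

lemma exp_smul_rankOneCurrent (t : ℂ) (α ξ : L) :
    NormedSpace.exp (t • rankOneCurrent α ξ) =
      Complex.exp (-(t * (1 / 2 * ⟪α, ξ⟫_ℂ))) • NormedSpace.exp (t • (create α * annih ξ)) := by
  let : NormedAlgebra ℚ (Op L) := NormedAlgebra.restrictScalars ℚ ℂ (Op L)
  rw [rankOneCurrent, smul_sub, smul_smul, sub_eq_add_neg, ← neg_smul,
    NormedSpace.exp_add_of_commute ((Commute.one_right _).smul_right _), exp_smul_one,
    mul_smul_comm, mul_one]

lemma exp_smul_rankOneCurrent_of_inner_ne_zero (t : ℂ) {α ξ : L} (h : ⟪α, ξ⟫_ℂ ≠ 0) :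
    NormedSpace.exp (t • rankOneCurrent α ξ) =
      Complex.exp (-(t * (1 / 2 * ⟪α, ξ⟫_ℂ))) •
        (1 + ((Complex.exp (t * ⟪α, ξ⟫_ℂ) - 1) / ⟪α, ξ⟫_ℂ) • (create α * annih ξ)) := by
  rw [exp_smul_rankOneCurrent, exp_smul_eq_of_sq h (create_annih_mul_self α ξ)]

lemma exp_smul_rankOneCurrent_of_inner_eq_zero (t : ℂ) {α ξ : L} (h : ⟪α, ξ⟫_ℂ = 0) :
    NormedSpace.exp (t • rankOneCurrent α ξ) = 1 + t • (create α * annih ξ) := by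
  have hsq : (t • (create α * annih ξ)) * (t • (create α * annih ξ)) = 0 := by
    rw [smul_mul_smul_comm, create_annih_mul_self, h, zero_smul, smul_zero]
  rw [exp_smul_rankOneCurrent, exp_eq_of_sq hsq, h, mul_zero, mul_zero, neg_zero, Complex.exp_zero,
    one_smul]

lemma exists_exp_smul_rankOneCurrent_eq (t : ℂ) (α ξ : L) : ∃ k κ : ℂ,
    NormedSpace.exp (t • rankOneCurrent α ξ) = k • (1 + κ • (create α * annih ξ)) := by
  by_cases h : ⟪α, ξ⟫_ℂ = 0
  · exact ⟨1, t, by rw [exp_smul_rankOneCurrent_of_inner_eq_zero t h, one_smul]⟩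
  · exact ⟨_, _, exp_smul_rankOneCurrent_of_inner_ne_zero t h⟩

/-- The commutator of a_α† a_ξ with a_β† is ⟨β, ξ⟩ a_α†, and the second-order term vanishes since
a_α† has square zero. The conjugation on the right compensates for the conjugate linearity of
`create`. -/
lemma one_add_mul_create (κ : ℂ) (α ξ β : L) :
    (1 + κ • (create α * annih ξ)) * create β =
      create (β + starRingEnd ℂ (κ * ⟪β, ξ⟫_ℂ) • α) * (1 + κ • (create α * annih ξ)) := by
  have h1 : create α * annih ξ * create β =
      ⟪β, ξ⟫_ℂ • create α + create β * (create α * annih ξ) := by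
    rw [mul_assoc, annih_mul_create, mul_sub, mul_smul_comm, mul_one, ← mul_assoc,
      create_mul_create α β, neg_mul, sub_neg_eq_add, mul_assoc]
  have h2 : create α * (create α * annih ξ) = 0 := by
    rw [← mul_assoc, create_mul_self, zero_mul]
  rw [create_add, create_smul, Complex.conj_conj]
  simp only [add_mul, mul_add, one_mul, mul_one, smul_mul_assoc, mul_smul_comm, h1, h2]
  module

lemma annih_mul_one_add (κ : ℂ) (α ξ η : L) :
    annih η * (1 + κ • (create α * annih ξ)) =
      (1 + κ • (create α * annih ξ)) * annih (η + (κ * ⟪α, η⟫_ℂ) • ξ) := by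
  have h1 : annih η * (create α * annih ξ) =
      ⟪α, η⟫_ℂ • annih ξ + create α * annih ξ * annih η := by
    rw [← mul_assoc, annih_mul_create, sub_mul, smul_mul_assoc, one_mul, mul_assoc,
      annih_mul_annih η ξ, mul_neg, sub_neg_eq_add, mul_assoc]
  have h2 : create α * annih ξ * annih ξ = 0 := by
    rw [mul_assoc, annih_mul_self, mul_zero]
  rw [annih_add, annih_smul]
  simp only [add_mul, mul_add, one_mul, mul_one, smul_mul_assoc, mul_smul_comm, h1, h2]
  module

lemma exists_create_of_mem_currentMonoid {h : Op L} (hh : h ∈ currentMonoid L) (α : L) :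
    ∃ α', h * create α = create α' * h := by
  induction hh using Submonoid.closure_induction generalizing α with
  | mem x hx =>
    obtain ⟨t, β, ξ, rfl⟩ := hx
    obtain ⟨k, κ, e⟩ := exists_exp_smul_rankOneCurrent_eq t β ξ
    rw [e]
    exact ⟨_, by rw [smul_mul_assoc, one_add_mul_create, mul_smul_comm]⟩
  | one => exact ⟨α, by rw [one_mul, mul_one]⟩
  | mul x y _ _ hx hy =>
    obtain ⟨α', e⟩ := hy α
    obtain ⟨α'', e'⟩ := hx α'
    exact ⟨α'', by rw [mul_assoc, e, ← mul_assoc, e', mul_assoc]⟩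

lemma exists_annih_of_mem_currentMonoid {h : Op L} (hh : h ∈ currentMonoid L) (ξ : L) :
    ∃ ξ', annih ξ * h = h * annih ξ' := by
  induction hh using Submonoid.closure_induction generalizing ξ with
  | mem x hx =>
    obtain ⟨t, β, η, rfl⟩ := hx
    obtain ⟨k, κ, e⟩ := exists_exp_smul_rankOneCurrent_eq t β η
    rw [e]
    exact ⟨_, by rw [smul_mul_assoc, mul_smul_comm, annih_mul_one_add]⟩
  | one => exact ⟨ξ, by rw [one_mul, mul_one]⟩
  | mul x y _ _ hx hy =>
    obtain ⟨ξ', e⟩ := hx ξ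
    obtain ⟨ξ'', e'⟩ := hy ξ'
    exact ⟨ξ'', by rw [← mul_assoc, e, mul_assoc, e', mul_assoc]⟩

lemma exists_createMonoid_of_mem_currentMonoid {h : Op L} (hh : h ∈ currentMonoid L) {p : Op L}
    (hp : p ∈ createMonoid L) : ∃ p' ∈ createMonoid L, h * p = p' * h := by
  induction hp using Submonoid.closure_induction with
  | mem x hx =>
    obtain ⟨α, rfl⟩ := hx
    obtain ⟨α', e⟩ := exists_create_of_mem_currentMonoid hh α
    exact ⟨_, Submonoid.subset_closure ⟨α', rfl⟩, by
      simp only [mul_add, add_mul, e, one_mul, mul_one]⟩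
  | one => exact ⟨1, one_mem _, by rw [one_mul, mul_one]⟩
  | mul x y _ _ hx hy =>
    obtain ⟨x', hx', e⟩ := hx
    obtain ⟨y', hy', e'⟩ := hy
    exact ⟨x' * y', mul_mem hx' hy', by rw [← mul_assoc, e, mul_assoc, e', mul_assoc]⟩

lemma exists_annihMonoid_of_mem_currentMonoid {h : Op L} (hh : h ∈ currentMonoid L) {q : Op L}
    (hq : q ∈ annihMonoid L) : ∃ q' ∈ annihMonoid L, q * h = h * q' := by
  induction hq using Submonoid.closure_induction with
  | mem x hx =>
    obtain ⟨ξ, rfl⟩ := hx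
    obtain ⟨ξ', e⟩ := exists_annih_of_mem_currentMonoid hh ξ
    exact ⟨_, Submonoid.subset_closure ⟨ξ', rfl⟩, by
      simp only [mul_add, add_mul, e, one_mul, mul_one]⟩
  | one => exact ⟨1, one_mem _, by rw [one_mul, mul_one]⟩
  | mul x y _ _ hx hy =>
    obtain ⟨x', hx', e⟩ := hx
    obtain ⟨y', hy', e'⟩ := hy
    exact ⟨x' * y', mul_mem hx' hy', by rw [mul_assoc, e', ← mul_assoc, e, mul_assoc]⟩

variable (L) in
/-- The products `p h q` of elements of the creation, current and annihilation monoids. -/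
def bigCell : Set (Op L) :=
  {x | ∃ p ∈ createMonoid L, ∃ h ∈ currentMonoid L, ∃ q ∈ annihMonoid L, x = p * h * q}

lemma createMonoid_mul_mem_closure_bigCell {p x : Op L} (hp : p ∈ createMonoid L)
    (hx : x ∈ closure (bigCell L)) : p * x ∈ closure (bigCell L) := by
  refine map_mem_closure (continuous_const_mul p) hx ?_
  rintro _ ⟨p', hp', h, hh, q, hq, rfl⟩
  exact ⟨p * p', mul_mem hp hp', h, hh, q, hq, by simp only [mul_assoc]⟩

/-- An element of the current monoid can be moved to the right past the creation factor, which stays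
in its monoid. -/
lemma currentMonoid_mul_mem_closure_bigCell {h x : Op L} (hh : h ∈ currentMonoid L)
    (hx : x ∈ closure (bigCell L)) : h * x ∈ closure (bigCell L) := by
  refine map_mem_closure (continuous_const_mul h) hx ?_
  rintro _ ⟨p, hp, h', hh', q, hq, rfl⟩
  obtain ⟨p', hp', e⟩ := exists_createMonoid_of_mem_currentMonoid hh hp
  exact ⟨p', hp', h * h', mul_mem hh hh', q, hq, by rw [← mul_assoc, ← mul_assoc, e,
    mul_assoc p']⟩

lemma mul_mem_closure_bigCell {h q x : Op L} (hh : h ∈ currentMonoid L) (hq : q ∈ annihMonoid L)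
    (hx : x ∈ closure (bigCell L)) : x * (h * q) ∈ closure (bigCell L) := by
  refine map_mem_closure (f := fun x => x * (h * q)) (continuous_mul_const (h * q)) hx ?_
  rintro _ ⟨p, hp, h', hh', q', hq', rfl⟩
  obtain ⟨q'', hq'', e⟩ := exists_annihMonoid_of_mem_currentMonoid hh hq'
  refine ⟨p, hp, h' * h, mul_mem hh' hh, q'' * q, mul_mem hq'' hq, ?_⟩
  calc p * h' * q' * (h * q) = p * h' * (q' * h) * q := by simp only [mul_assoc]
    _ = _ := by rw [e]; simp only [mul_assoc]

/-- The decomposition of `exp a_ξ exp a_α†`. -/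
lemma one_add_annih_mul_one_add_create {α ξ : L} (hk : 1 + ⟪α, ξ⟫_ℂ ≠ 0) :
    ∃ h ∈ currentMonoid L, ∃ β η : L,
      (1 + annih ξ) * (1 + create α) = (1 + create β) * h * (1 + annih η) := by
  set s := ⟪α, ξ⟫_ℂ with hs
  set k := 1 + s with hkdef
  -- The left side of the decomposition is k + a_ξ + a_α† - a_α† a_ξ. With outer factors 1 + k⁻¹
  -- a_α† and 1 + k⁻¹ a_ξ, comparison of coefficients forces this h.
  obtain ⟨h, hh, e⟩ : ∃ h ∈ currentMonoid L,
      h = k • (1 : Op L) - ((1 + k) / k) • (create α * annih ξ) := by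
    refine ⟨_, ?_, rfl⟩
    by_cases h0 : s = 0
    · refine Submonoid.subset_closure ⟨-2, α, ξ, ?_⟩
      rw [exp_smul_rankOneCurrent_of_inner_eq_zero _ h0, hkdef, h0]
      module
    -- The parameter t satisfies exp (-t s / 2) = k. The coefficient k (k⁻² - 1) / s then equals -(1
    -- + k) / k, because s = k - 1.
    · refine Submonoid.subset_closure ⟨-2 * Complex.log k / s, α, ξ, ?_⟩
      rw [exp_smul_rankOneCurrent_of_inner_ne_zero _ h0, ← hs]
      have h1 : Complex.exp (-(-2 * Complex.log k / s * (1 / 2 * s))) = k := by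
        have : -(-2 * Complex.log k / s * (1 / 2 * s)) = Complex.log k := by
          field_simp
        rw [this, Complex.exp_log hk]
      have h2 : Complex.exp (-2 * Complex.log k / s * s) = (k * k)⁻¹ := by
        have : -2 * Complex.log k / s * s = -(Complex.log k + Complex.log k) := by
          field_simp
          ring
        rw [this, Complex.exp_neg, Complex.exp_add, Complex.exp_log hk]
      rw [h1, h2, smul_add, smul_smul, sub_eq_add_neg, ← neg_smul]
      congr 2
      field_simp
      rw [hkdef]
      ring
  refine ⟨h, hh, starRingEnd ℂ k⁻¹ • α, k⁻¹ • ξ, ?_⟩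
  have h1 : create α * (create α * annih ξ) = 0 := by
    rw [← mul_assoc, create_mul_self, zero_mul]
  have h2 : create α * annih ξ * annih ξ = 0 := by
    rw [mul_assoc, annih_mul_self, mul_zero]
  rw [e, create_smul, Complex.conj_conj, annih_smul]
  simp only [add_mul, mul_add, sub_mul, mul_sub, one_mul, mul_one, smul_mul_assoc, mul_smul_comm,
    h1, h2, annih_mul_create, ← hs, smul_zero, sub_zero, add_zero]
  match_scalars <;> field_simp
  rw [hkdef]
  ring

lemma dense_setOf_one_add_mul_ne_zero (s : ℂ) : Dense {t : ℂ | 1 + t * s ≠ 0} := by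
  have h : {t : ℂ | 1 + t * s = 0}.Subsingleton := by
    intro t ht u hu
    have hs : s ≠ 0 := by
      rintro rfl
      simp at ht
    exact mul_right_cancel₀ hs (add_left_cancel (ht.trans hu.symm))
  exact h.countable.dense_compl ℂ

/-- Exchanging 1 + a_ξ with the first creation factor leaves some 1 + a_η to the left of the
remaining ones, so the induction must run over all ξ. If the exchange is singular, ξ is replaced by
tξ with t tending to 1. -/
lemma one_add_annih_mul_mem_closure_bigCell {p : Op L} (hp : p ∈ createMonoid L) (ξ : L) :
    (1 + annih ξ) * p ∈ closure (bigCell L) := by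
  induction hp using Submonoid.closure_induction_left generalizing ξ with
  | one =>
    exact subset_closure ⟨1, one_mem _, 1, one_mem _, _, Submonoid.subset_closure ⟨ξ, rfl⟩, by
      rw [mul_one, mul_one, one_mul]⟩
  | mul_left x hx y _ ih =>
    obtain ⟨α, rfl⟩ := hx
    have hc : Continuous fun t : ℂ => (1 + annihL (t • ξ)) * ((1 + create α) * y) := by fun_prop
    have hcl := (isClosed_closure (s := bigCell L)).preimage hc
    have hsub : {t : ℂ | 1 + t * ⟪α, ξ⟫_ℂ ≠ 0} ⊆
        (fun t : ℂ => (1 + annihL (t • ξ)) * ((1 + create α) * y)) ⁻¹' closure (bigCell L) := by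
      intro t ht
      obtain ⟨h, hh, β, η, e⟩ := one_add_annih_mul_one_add_create (α := α) (ξ := t • ξ)
        (by rwa [inner_smul_right])
      change (1 + annih (t • ξ)) * ((1 + create α) * y) ∈ closure (bigCell L)
      rw [← mul_assoc, e, mul_assoc, mul_assoc]
      exact createMonoid_mul_mem_closure_bigCell (Submonoid.subset_closure ⟨β, rfl⟩)
        (currentMonoid_mul_mem_closure_bigCell hh (ih η))
    have := hcl.closure_subset_iff.2 hsub
      ((dense_setOf_one_add_mul_ne_zero ⟪α, ξ⟫_ℂ) 1)
    simpa using this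

variable (L) in
/-- The monoid generated by the exponentials of creation and annihilation operators. -/
def fieldMonoid : Submonoid (Op L) := Submonoid.closure
  ((Set.range fun ξ : L => 1 + annih ξ) ∪ Set.range fun ξ : L => 1 + create ξ)

/-- The big cell is dense. -/
theorem fieldMonoid_topologicalClosure_subset :
    ((fieldMonoid L).topologicalClosure : Set (Op L)) ⊆ closure (bigCell L) := by
  change closure (fieldMonoid L : Set (Op L)) ⊆ _
  refine closure_minimal (fun x hx => ?_) isClosed_closure
  induction hx using Submonoid.closure_induction_left with
  | one =>
    exact subset_closure ⟨1, one_mem _, 1, one_mem _, 1, one_mem _, by simp only [mul_one]⟩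
  | mul_left x hx y _ ih =>
    -- In the annihilation case a point of the cell is moved only into the closure of the cell, so
    -- the closure is taken twice.
    rcases hx with ⟨ξ, rfl⟩ | ⟨ξ, rfl⟩
    · rw [← closure_closure]
      refine map_mem_closure (continuous_const_mul (1 + annih ξ)) ih ?_
      rintro _ ⟨p, hp, h, hh, q, hq, rfl⟩
      simp only
      rw [mul_assoc p, ← mul_assoc (1 + annih ξ)]
      exact mul_mem_closure_bigCell hh hq (one_add_annih_mul_mem_closure_bigCell hp ξ)
    · exact createMonoid_mul_mem_closure_bigCell (Submonoid.subset_closure ⟨ξ, rfl⟩) ih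

end BigCell

end

end FermiFock

/-! ### The Lie product formula and the Lie algebra of a closed monoid -/

section Trotter

open Filter Topology

variable {A : Type*} [NormedRing A] [NormedAlgebra ℂ A] [CompleteSpace A]

lemma norm_exp_le_exp_norm [NormOneClass A] (x : A) :
    ‖NormedSpace.exp x‖ ≤ Real.exp ‖x‖ := by
  have h1 := NormedSpace.exp_series_hasSum_exp' (𝕂 := ℂ) x
  have h2 := NormedSpace.exp_series_hasSum_exp' (𝕂 := ℝ) ‖x‖
  rw [← Real.exp_eq_exp_ℝ] at h2
  refine h1.norm_le_of_bounded h2 fun n => ?_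
  rw [norm_smul, norm_inv, Complex.norm_natCast, smul_eq_mul]
  gcongr
  exact norm_pow_le x n

lemma norm_pow_sub_pow_le {A : Type*} [NormedRing A] [NormOneClass A] {a b : A} {M : ℝ} (ha : ‖a‖ ≤ M) (hb : ‖b‖ ≤ M)
    (hM : 1 ≤ M) (n : ℕ) : ‖a ^ n - b ^ n‖ ≤ n * M ^ n * ‖a - b‖ := by
  induction n with
  | zero => simp
  | succ n ih =>
    have h : a ^ (n + 1) - b ^ (n + 1) = a * (a ^ n - b ^ n) + (a - b) * b ^ n := by
      rw [pow_succ', pow_succ', mul_sub, sub_mul, sub_add_sub_cancel]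
    have hbn : ‖b ^ n‖ ≤ M ^ n := (norm_pow_le b n).trans (by gcongr)
    have hMn : M ^ n ≤ M ^ (n + 1) := pow_le_pow_right₀ hM n.le_succ
    calc ‖a ^ (n + 1) - b ^ (n + 1)‖ ≤ ‖a‖ * ‖a ^ n - b ^ n‖ + ‖a - b‖ * ‖b ^ n‖ := by
          rw [h]
          exact (norm_add_le _ _).trans (add_le_add (norm_mul_le _ _) (norm_mul_le _ _))
      _ ≤ M * (n * M ^ n * ‖a - b‖) + ‖a - b‖ * M ^ (n + 1) := by
          gcongr
          exact hbn.trans hMn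
      _ = (n + 1 : ℕ) * M ^ (n + 1) * ‖a - b‖ := by
          push_cast
          ring

/-- The Lie product formula. -/
theorem tendsto_exp_mul_exp_pow [NormOneClass A] (x y : A) :
    Tendsto (fun n : ℕ => (NormedSpace.exp ((n : ℂ)⁻¹ • x) * NormedSpace.exp ((n : ℂ)⁻¹ • y)) ^ n)
      atTop (𝓝 (NormedSpace.exp (x + y))) := by
  let : NormedAlgebra ℚ A := NormedAlgebra.restrictScalars ℚ ℂ A
  -- The error of a single step vanishes to first order at 0, so it is o(1/n) at 1/n. Passing to
  -- n-th powers costs at most the factor n exp (‖x‖ + ‖y‖).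
  let F : ℂ → A := fun t => NormedSpace.exp (t • x) * NormedSpace.exp (t • y) -
    NormedSpace.exp (t • (x + y))
  have hF0 : F 0 = 0 := by simp [F]
  have hF : HasDerivAt F 0 0 := by
    have h1 := (hasDerivAt_exp_smul_const (𝕂 := ℂ) x 0).mul
      (hasDerivAt_exp_smul_const (𝕂 := ℂ) y 0)
    have h2 := h1.sub (hasDerivAt_exp_smul_const (𝕂 := ℂ) (x + y) 0)
    simp only [zero_smul, NormedSpace.exp_zero, one_mul, mul_one, sub_self] at h2
    exact h2
  have ht : Tendsto (fun n : ℕ => (n : ℂ)⁻¹) atTop (𝓝 0) := tendsto_inv_atTop_nhds_zero_nat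
  have ho : (fun n : ℕ => F (n : ℂ)⁻¹) =o[atTop] fun n : ℕ => (n : ℂ)⁻¹ := by
    have := hF.isLittleO
    simp only [hF0, sub_zero, smul_zero] at this
    exact this.comp_tendsto ht
  have hlim := (ho.norm_norm.tendsto_div_nhds_zero).const_mul (Real.exp (‖x‖ + ‖y‖))
  rw [mul_zero] at hlim
  have hsq : Tendsto (fun n : ℕ =>
      (NormedSpace.exp ((n : ℂ)⁻¹ • x) * NormedSpace.exp ((n : ℂ)⁻¹ • y)) ^ n -
        NormedSpace.exp ((n : ℂ)⁻¹ • (x + y)) ^ n) atTop (𝓝 0) := by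
    refine squeeze_zero_norm' ?_ hlim
    filter_upwards [eventually_gt_atTop 0] with n hn
    have hn' : (0 : ℝ) < n := Nat.cast_pos.2 hn
    have e : Real.exp ((‖x‖ + ‖y‖) / n) ^ n = Real.exp (‖x‖ + ‖y‖) := by
      rw [← Real.exp_nat_mul]
      congr 1
      field_simp
    have hns : ∀ z : A, ‖(n : ℂ)⁻¹ • z‖ = ‖z‖ / n := fun z => by
      rw [norm_smul, norm_inv, Complex.norm_natCast, inv_mul_eq_div]
    refine (norm_pow_sub_pow_le (M := Real.exp ((‖x‖ + ‖y‖) / n)) ?_ ?_ ?_ n).trans_eq ?_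
    · refine (norm_mul_le _ _).trans ?_
      rw [add_div, Real.exp_add, ← hns x, ← hns y]
      exact mul_le_mul (norm_exp_le_exp_norm _) (norm_exp_le_exp_norm _) (norm_nonneg _)
        (Real.exp_nonneg _)
    · refine (norm_exp_le_exp_norm _).trans (Real.exp_le_exp.2 ?_)
      rw [hns]
      gcongr
      exact norm_add_le x y
    · exact Real.one_le_exp (by positivity)
    · rw [e, norm_inv, Complex.norm_natCast, div_inv_eq_mul]
      simp only [F]
      ring
  have hconst : ∀ᶠ n : ℕ in atTop,
      NormedSpace.exp ((n : ℂ)⁻¹ • (x + y)) ^ n = NormedSpace.exp (x + y) := by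
    filter_upwards [eventually_gt_atTop 0] with n hn
    rw [← NormedSpace.exp_nsmul, ← Nat.cast_smul_eq_nsmul ℂ, smul_smul,
      mul_inv_cancel₀ (Nat.cast_ne_zero.2 hn.ne'), one_smul]
  have := hsq.add (tendsto_const_nhds.congr' (hconst.mono fun _ h => h.symm))
  simpa using this

/-- The elements whose one-parameter group lies in a closed monoid. -/
def Submonoid.lieSubspace [NormOneClass A] (M : Submonoid A) (hM : IsClosed (M : Set A)) :
    Submodule ℂ A where
  carrier := {x | ∀ t : ℂ, NormedSpace.exp (t • x) ∈ M}
  zero_mem' t := by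
    rw [smul_zero, NormedSpace.exp_zero]
    exact one_mem M
  add_mem' {x y} hx hy t := by
    rw [smul_add]
    refine hM.mem_of_tendsto (tendsto_exp_mul_exp_pow (t • x) (t • y))
      (Eventually.of_forall fun n => pow_mem (mul_mem ?_ ?_) n)
    · rw [smul_smul]
      exact hx _
    · rw [smul_smul]
      exact hy _
  smul_mem' c x hx t := by
    rw [smul_smul]
    exact hx _

variable [NormOneClass A] {M : Submonoid A} {hM : IsClosed (M : Set A)}

lemma Submonoid.isClosed_lieSubspace : IsClosed (M.lieSubspace hM : Set A) := by
  let : NormedAlgebra ℚ A := NormedAlgebra.restrictScalars ℚ ℂ A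
  have : (M.lieSubspace hM : Set A) =
      ⋂ t : ℂ, (fun x => NormedSpace.exp (t • x)) ⁻¹' (M : Set A) := by
    ext x
    simp only [Set.mem_iInter]
    rfl
  rw [this]
  exact isClosed_iInter fun t =>
    hM.preimage (NormedSpace.exp_continuous.comp (continuous_const_smul t))

/-- Conjugation commutes with the exponential. The inverse v is required to lie in M because M is
only a monoid. -/
lemma Submonoid.conj_mem_lieSubspace {x u v : A} (hx : x ∈ M.lieSubspace hM) (hu : u ∈ M)
    (hv : v ∈ M) (huv : u * v = 1) (hvu : v * u = 1) : u * x * v ∈ M.lieSubspace hM := by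
  let : NormedAlgebra ℚ A := NormedAlgebra.restrictScalars ℚ ℂ A
  intro t
  have := NormedSpace.exp_units_conj (⟨u, v, huv, hvu⟩ : Aˣ) (t • x)
  simp only [Units.inv_mk, mul_smul_comm, smul_mul_assoc] at this
  rw [this]
  exact mul_mem (mul_mem hu (hx t)) hv

lemma Submonoid.mem_lieSubspace_of_hasSum {κ : Type*} {f : κ → A} {a : A} (hf : HasSum f a)
    (h : ∀ i, f i ∈ M.lieSubspace hM) : a ∈ M.lieSubspace hM :=
  Submonoid.isClosed_lieSubspace.mem_of_tendsto hf
    (Eventually.of_forall fun _ => Submodule.sum_mem _ fun i _ => h i)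

end Trotter

/-! ### Creation and annihilation operators generate the group topologically -/

namespace FermiFock

noncomputable section

section Generation

variable {L : Type*} [NormedAddCommGroup L] [InnerProductSpace ℂ L] [CompleteSpace L]

scoped instance : Nontrivial (Fock L) := ⟨vacuum L, 0, vacuum_ne_zero⟩

scoped instance : NormOneClass (Op L) := inferInstance

variable (L) in
/-- The Lie algebra of the closure of the monoid generated by the exponentials of creation and
annihilation operators. -/
def fieldLie : Submodule ℂ (Op L) :=
  (fieldMonoid L).topologicalClosure.lieSubspace (fieldMonoid L).isClosed_topologicalClosure

lemma one_add_annih_mem (ξ : L) : 1 + annih ξ ∈ (fieldMonoid L).topologicalClosure :=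
  (fieldMonoid L).le_topologicalClosure (Submonoid.subset_closure (Or.inl ⟨ξ, rfl⟩))

lemma one_add_create_mem (ξ : L) : 1 + create ξ ∈ (fieldMonoid L).topologicalClosure :=
  (fieldMonoid L).le_topologicalClosure (Submonoid.subset_closure (Or.inr ⟨ξ, rfl⟩))

lemma annih_mem_fieldLie (ξ : L) : annih ξ ∈ fieldLie L := fun t => by
  rw [← annih_smul, exp_annih]
  exact one_add_annih_mem _

lemma create_mem_fieldLie (ξ : L) : create ξ ∈ fieldLie L := fun t => by
  have : t • create ξ = create (starRingEnd ℂ t • ξ) := by rw [create_smul, Complex.conj_conj]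
  rw [this, exp_create]
  exact one_add_create_mem _

lemma conj_one_add_annih_mem_fieldLie {x : Op L} (hx : x ∈ fieldLie L) (ξ : L) :
    (1 + annih ξ) * x * (1 + annih (-ξ)) ∈ fieldLie L := by
  refine Submonoid.conj_mem_lieSubspace hx (one_add_annih_mem ξ) (one_add_annih_mem (-ξ)) ?_ ?_
  all_goals
    rw [annih_neg]
    simp only [mul_add, add_mul, mul_neg, neg_mul, annih_mul_self, one_mul, mul_one]
    abel

/-- Brackets are obtained from conjugation: conjugating a_η by exp a_ξ gives a_η + [a_ξ, a_η], as
the higher brackets vanish, and the commutator is 2 a_ξ a_η. -/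
lemma annih_mul_annih_mem_fieldLie (ξ η : L) : annih ξ * annih η ∈ fieldLie L := by
  have h := conj_one_add_annih_mem_fieldLie (annih_mem_fieldLie η) ξ
  have e : (1 + annih ξ) * annih η * (1 + annih (-ξ)) = annih η + (2 : ℂ) • (annih ξ * annih η) := by
    have h1 : annih ξ * annih η * annih ξ = 0 := by
      rw [mul_assoc, annih_mul_annih η, mul_neg, ← mul_assoc, annih_mul_self, zero_mul, neg_zero]
    rw [annih_neg]
    simp only [mul_add, add_mul, mul_neg, one_mul, mul_one, h1]
    rw [annih_mul_annih η ξ]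
    module
  rw [e, Submodule.add_mem_iff_right _ (annih_mem_fieldLie η)] at h
  exact (Submodule.smul_mem_iff _ two_ne_zero).1 h

/-- Conjugating a_β† by exp a_ξ adds the commutator and a second-order term, which is a multiple of
a_ξ and can be removed. -/
lemma annih_create_commutator_mem_fieldLie (ξ β : L) :
    annih ξ * create β - create β * annih ξ ∈ fieldLie L := by
  have h := conj_one_add_annih_mem_fieldLie (create_mem_fieldLie β) ξ
  have e : (1 + annih ξ) * create β * (1 + annih (-ξ)) =
      create β + (annih ξ * create β - create β * annih ξ) - ⟪β, ξ⟫_ℂ • annih ξ := by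
    have h1 : annih ξ * create β * annih ξ = ⟪β, ξ⟫_ℂ • annih ξ := by
      rw [annih_mul_create, sub_mul, smul_mul_assoc, one_mul, mul_assoc, annih_mul_self, mul_zero,
        sub_zero]
    rw [annih_neg]
    simp only [mul_add, add_mul, mul_neg, one_mul, mul_one, h1]
    abel
  rw [e] at h
  have h2 := Submodule.add_mem _ h (Submodule.smul_mem _ ⟪β, ξ⟫_ℂ (annih_mem_fieldLie ξ))
  rwa [sub_add_cancel, Submodule.add_mem_iff_right _ (create_mem_fieldLie β)] at h2

lemma create_mul_create_mem_fieldLie (ξ η : L) : create ξ * create η ∈ fieldLie L := by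
  have h := Submonoid.conj_mem_lieSubspace (create_mem_fieldLie η) (one_add_create_mem ξ)
    (one_add_create_mem (-ξ)) (by
      rw [create_neg]
      simp only [mul_add, add_mul, mul_neg, create_mul_self, one_mul, mul_one]
      abel) (by
      rw [create_neg]
      simp only [mul_add, add_mul, neg_mul, create_mul_self, one_mul, mul_one]
      abel)
  have e : (1 + create ξ) * create η * (1 + create (-ξ)) =
      create η + (2 : ℂ) • (create ξ * create η) := by
    have h1 : create ξ * create η * create ξ = 0 := by
      rw [mul_assoc, create_mul_create η, mul_neg, ← mul_assoc, create_mul_self, zero_mul,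
        neg_zero]
    rw [create_neg]
    simp only [mul_add, add_mul, mul_neg, one_mul, mul_one, h1]
    rw [create_mul_create η ξ]
    module
  change _ ∈ fieldLie L at h
  rw [e, Submodule.add_mem_iff_right _ (create_mem_fieldLie η)] at h
  exact (Submodule.smul_mem_iff _ two_ne_zero).1 h

variable {ι : Type*} {b : HilbertBasis ι ℂ L}

/-- The subspace is closed in norm, so it contains a convergent series once it contains each term,
and these terms are quadratic in the fields. -/
lemma gC_subset_fieldLie : gC b ⊆ (fieldLie L : Set (Op L)) := by
  rintro _ ⟨_, ⟨T, ⟨ℓ, _, hℓ⟩, _, ⟨S, ⟨Λ, _, hΛ⟩, _, ⟨S', ⟨Λ', _, hΛ'⟩, rfl⟩, rfl⟩, rfl⟩,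
    _, ⟨_, ⟨ξ, rfl⟩, _, ⟨_, ⟨η, rfl⟩, rfl⟩, rfl⟩, rfl⟩
  refine add_mem (add_mem ?_ (add_mem ?_ ?_)) (add_mem ?_ ?_)
  · refine Submonoid.mem_lieSubspace_of_hasSum hℓ fun i => Submodule.smul_mem _ _ ?_
    rw [← neg_sub]
    exact neg_mem (annih_create_commutator_mem_fieldLie _ _)
  · exact Submonoid.mem_lieSubspace_of_hasSum hΛ fun i =>
      Submodule.smul_mem _ _ (annih_mul_annih_mem_fieldLie _ _)
  · refine Submonoid.mem_lieSubspace_of_hasSum hΛ'.star fun i => ?_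
    rw [star_smul, star_mul, star_annih, star_annih]
    exact Submodule.smul_mem _ _ (create_mul_create_mem_fieldLie _ _)
  · exact Submodule.smul_mem _ _ (annih_mem_fieldLie ξ)
  · change star (_ • annih η) ∈ fieldLie L
    rw [star_smul, star_annih]
    exact Submodule.smul_mem _ _ (create_mem_fieldLie η)

/-- The group is contained in the closure of the big cell. -/
theorem GAlg_subset_closure_bigCell : (GAlg b : Set (Op L)) ⊆ closure (bigCell L) := by
  refine Set.Subset.trans ?_ fieldMonoid_topologicalClosure_subset
  refine (Submonoid.closure_le (S := (fieldMonoid L).topologicalClosure)).2 ?_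
  rintro _ ⟨x, hx, rfl⟩
  simpa using gC_subset_fieldLie hx 1

end Generation

end

end FermiFock

/-! ### Second quantization of matrices and exponentials of currents -/

/-- Exponentials of intertwined elements are intertwined. -/
lemma exp_mul_map_one {A B : Type*} [NormedRing A] [NormedAlgebra ℂ A] [CompleteSpace A]
    [NormedRing B] [NormedAlgebra ℂ B] [CompleteSpace B] (D : B →L[ℂ] A) {x : A} {y : B}
    (h : ∀ z, x * D z = D z * x + D (y * z)) :
    NormedSpace.exp x * D 1 = D (NormedSpace.exp y) * NormedSpace.exp x := by
  -- The intertwining relation, applied at z = exp (t y), makes the derivative of f vanish. The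
  -- claim is f 1 = f 0.
  let f : ℂ → A := fun t =>
    NormedSpace.exp (t • -x) * D (NormedSpace.exp (t • y)) * NormedSpace.exp (t • x)
  have hf : ∀ t, HasDerivAt f 0 t := by
    intro t
    have h1 := hasDerivAt_exp_smul_const (𝕂 := ℂ) (-x) t
    have h2 := D.hasFDerivAt.comp_hasDerivAt t (hasDerivAt_exp_smul_const' (𝕂 := ℂ) y t)
    have h3 := hasDerivAt_exp_smul_const' (𝕂 := ℂ) x t
    have h4 := (h1.mul h2).mul h3
    refine h4.congr_deriv ?_
    have := h (NormedSpace.exp (t • y))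
    simp only [Function.comp_apply, Pi.mul_apply]
    rw [← mul_assoc _ x, ← add_mul, mul_assoc _ (-x), mul_assoc _ _ x, ← mul_add, ← mul_add,
      neg_mul, this]
    have h5 : -(D (NormedSpace.exp (t • y)) * x + D (y * NormedSpace.exp (t • y))) +
        D (y * NormedSpace.exp (t • y)) + D (NormedSpace.exp (t • y)) * x = 0 := by abel
    rw [h5, mul_zero, zero_mul]
  have h0 := is_const_of_deriv_eq_zero (fun t => (hf t).differentiableAt)
    (fun t => (hf t).deriv) 1 0
  simp only [f, one_smul, zero_smul, NormedSpace.exp_zero, one_mul, mul_one] at h0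
  rw [← h0, ← mul_assoc, ← mul_assoc, FermiFock.exp_mul_exp_neg_self, one_mul]

namespace FermiFock

noncomputable section

section SecondQuantization

open Matrix

attribute [local instance] Matrix.linftyOpNormedRing Matrix.linftyOpNormedAlgebra

variable {L : Type*} [NormedAddCommGroup L] [InnerProductSpace ℂ L] [CompleteSpace L]
variable {n : Type*} [Fintype n]

lemma rankOneCurrent_mul_create (α ξ β : L) : rankOneCurrent α ξ * create β =
    create β * rankOneCurrent α ξ + ⟪β, ξ⟫_ℂ • create α := by
  rw [rankOneCurrent, sub_mul, mul_sub, smul_mul_assoc, one_mul, mul_smul_comm, mul_one,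
    mul_assoc, annih_mul_create, mul_sub, mul_smul_comm, mul_one, ← mul_assoc, ← mul_assoc,
    create_mul_create α β, neg_mul]
  abel

lemma rankOneCurrent_vacuum (α ξ : L) :
    rankOneCurrent α ξ (vacuum L) = -(1 / 2 * ⟪α, ξ⟫_ℂ) • vacuum L := by
  rw [rankOneCurrent, _root_.sub_apply, mul_apply_eq_comp, annih_vacuum, map_zero,
    _root_.smul_apply,
    one_apply_eq_self, zero_sub, neg_smul]

/-- The current operator of a matrix. -/
def dGamma (e : n → L) : Matrix n n ℂ →ₗ[ℂ] Op L where
  toFun X := ∑ i, ∑ j, X i j • rankOneCurrent (e i) (e j)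
  map_add' X Y := by simp only [Matrix.add_apply, add_smul, Finset.sum_add_distrib]
  map_smul' c X := by
    simp only [Matrix.smul_apply, smul_eq_mul, mul_smul, Finset.smul_sum, RingHom.id_apply]

lemma dGamma_apply (e : n → L) (X : Matrix n n ℂ) :
    dGamma e X = ∑ i, ∑ j, X i j • rankOneCurrent (e i) (e j) := rfl

lemma continuous_dGamma (e : n → L) : Continuous (dGamma e) :=
  (dGamma e).continuous_of_finiteDimensional

variable {e : n → L}

lemma dGamma_mul_create_of_orthogonal (X : Matrix n n ℂ) {η : L} (hη : ∀ i, ⟪e i, η⟫_ℂ = 0) :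
    Commute (dGamma e X) (create η) := by
  refine Commute.sum_left _ _ _ fun i _ => Commute.sum_left _ _ _ fun j _ => ?_
  refine Commute.smul_left ?_ _
  rw [Commute, SemiconjBy, rankOneCurrent_mul_create, ← inner_conj_symm, hη, map_zero, zero_smul,
    add_zero]

/-- The operator `h` transforms creation operators by the matrix `X` on the span of `e` and
trivially on its orthogonal complement, and multiplies the vacuum vector by `k`. -/
structure Implements (e : n → L) (h : Op L) (X : Matrix n n ℂ) (k : ℂ) : Prop where
  mul_create : ∀ j, h * create (e j) = (∑ i, X i j • create (e i)) * h
  commute : ∀ η, (∀ i, ⟪e i, η⟫_ℂ = 0) → h * create η = create η * h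
  vacuum : h (vacuum L) = k • vacuum L

/-- Every creation operator splits along the span of `e` and its orthogonal complement, and h and h'
move it to the left as the same operator T. Finite-particle vectors are generated from the vacuum by
creation operators. -/
lemma Implements.eq (he : Orthonormal ℂ e) {h h' : Op L} {X : Matrix n n ℂ} {k : ℂ}
    (H : Implements e h X k) (H' : Implements e h' X k) : h = h' := by
  have key : ∀ ξ, ∃ T : Op L, h * create ξ = T * h ∧ h' * create ξ = T * h' := by
    intro ξ
    obtain ⟨η, hη, e1⟩ : ∃ η, (∀ i, ⟪e i, η⟫_ℂ = 0) ∧ ξ = ∑ i, ⟪e i, ξ⟫_ℂ • e i + η := by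
      refine ⟨ξ - ∑ i, ⟪e i, ξ⟫_ℂ • e i, fun i => ?_, (add_sub_cancel _ _).symm⟩
      rw [inner_sub_right, he.inner_right_fintype, sub_self]
    have e2 : create ξ = ∑ j, ⟪ξ, e j⟫_ℂ • create (e j) + create η := by
      conv_lhs => rw [e1]
      rw [create_add, ← createL_apply, map_sum]
      simp only [createL_apply, create_smul, inner_conj_symm]
    refine ⟨∑ j, ⟪ξ, e j⟫_ℂ • (∑ i, X i j • create (e i)) + create η, ?_, ?_⟩
    · rw [e2, mul_add, add_mul, H.commute η hη, Finset.mul_sum, Finset.sum_mul]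
      simp only [mul_smul_comm, smul_mul_assoc, H.mul_create]
    · rw [e2, mul_add, add_mul, H'.commute η hη, Finset.mul_sum, Finset.sum_mul]
      simp only [mul_smul_comm, smul_mul_assoc, H'.mul_create]
  refine op_ext fun x => ?_
  induction x using PreFock.induction with
  | hr r => rw [coe_algebraMap, map_smul, map_smul, H.vacuum, H'.vacuum]
  | hadd x y hx hy => rw [UniformSpace.Completion.coe_add, map_add, map_add, hx, hy]
  | hmul ξ x hx =>
    obtain ⟨T, h1, h2⟩ := key ξ
    rw [← create_coe, ← mul_apply_eq_comp, ← mul_apply_eq_comp, h1, h2, mul_apply_eq_comp,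
      mul_apply_eq_comp, hx]

lemma Implements.mul {h h' : Op L} {X X' : Matrix n n ℂ} {k k' : ℂ}
    (H : Implements e h X k) (H' : Implements e h' X' k') :
    Implements e (h * h') (X * X') (k * k') where
  mul_create j := by
    have : h * (∑ i, X' i j • create (e i)) = (∑ i, (X * X') i j • create (e i)) * h := by
      simp only [Finset.mul_sum, Finset.sum_mul, mul_smul_comm, smul_mul_assoc, H.mul_create,
        Finset.smul_sum, smul_smul, Matrix.mul_apply, Finset.sum_smul]
      rw [Finset.sum_comm]
      refine Finset.sum_congr rfl fun i _ => Finset.sum_congr rfl fun l _ => ?_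
      rw [mul_comm]
    rw [mul_assoc, H'.mul_create, ← mul_assoc, this, mul_assoc]
  commute η hη := by rw [mul_assoc, H'.commute η hη, ← mul_assoc, H.commute η hη, mul_assoc]
  vacuum := by rw [mul_apply_eq_comp, H'.vacuum, map_smul, H.vacuum, smul_smul, mul_comm]

variable {ι : Type*} {b : HilbertBasis ι ℂ L}

lemma exp_dGamma_mem_HC (e : n → L) (X : Matrix n n ℂ) : NormedSpace.exp (dGamma e X) ∈ HC b :=
  ⟨_, finiteCurrents_subset_hC (Submodule.sum_mem _ fun _ _ => Submodule.sum_mem _ fun _ _ =>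
    Submodule.smul_mem _ _ (create_mul_annih_mem_finiteCurrents _ _)), rfl⟩

variable [DecidableEq n]

lemma dGamma_mul_create (he : Orthonormal ℂ e) (X : Matrix n n ℂ) (k : n) :
    dGamma e X * create (e k) = create (e k) * dGamma e X + ∑ i, X i k • create (e i) := by
  simp only [dGamma_apply, Finset.sum_mul, Finset.mul_sum, smul_mul_assoc, mul_smul_comm,
    rankOneCurrent_mul_create, smul_add, Finset.sum_add_distrib, orthonormal_iff_ite.1 he,
    ite_smul, one_smul, zero_smul, smul_ite, smul_zero, Finset.sum_ite_eq, Finset.mem_univ,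
    if_true]

lemma dGamma_vacuum (he : Orthonormal ℂ e) (X : Matrix n n ℂ) :
    dGamma e X (vacuum L) = -(1 / 2 * X.trace) • vacuum L := by
  simp only [dGamma_apply, _root_.sum_apply, _root_.smul_apply, rankOneCurrent_vacuum,
    orthonormal_iff_ite.1 he, smul_smul, Matrix.trace, Matrix.diag_apply, ← Finset.sum_smul]
  congr 1
  simp [Finset.mul_sum, mul_comm]

lemma Implements.one : Implements e (1 : Op L) 1 1 where
  mul_create j := by simp [Matrix.one_apply]
  commute η _ := by rw [one_mul, mul_one]
  vacuum := by rw [one_apply_eq_self, one_smul]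

lemma implements_exp_dGamma (he : Orthonormal ℂ e) (X : Matrix n n ℂ) :
    Implements e (NormedSpace.exp (dGamma e X)) (NormedSpace.exp X)
      (Complex.exp (-(1 / 2 * X.trace))) where
  mul_create j := by
    -- Column j of Y read as a combination of creation operators: commuting with `dGamma e X`
    -- becomes left multiplication by X.
    let D₀ : Matrix n n ℂ →ₗ[ℂ] Op L :=
      { toFun := fun Y => ∑ i, Y i j • create (e i)
        map_add' := fun Y Z => by
          simp only [Matrix.add_apply, add_smul, Finset.sum_add_distrib]
        map_smul' := fun c Y => by
          simp only [Matrix.smul_apply, smul_eq_mul, mul_smul, Finset.smul_sum,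
            RingHom.id_apply] }
    let D : Matrix n n ℂ →L[ℂ] Op L := ⟨D₀, D₀.continuous_of_finiteDimensional⟩
    have hD : ∀ Y, D Y = ∑ i, Y i j • create (e i) := fun _ => rfl
    have h1 : D 1 = create (e j) := by simp [hD, Matrix.one_apply]
    have hcomm : ∀ Y : Matrix n n ℂ, dGamma e X * ∑ i, Y i j • create (e i) =
        (∑ i, Y i j • create (e i)) * dGamma e X + ∑ i, (X * Y) i j • create (e i) := by
      intro Y
      simp only [Finset.mul_sum, Finset.sum_mul, mul_smul_comm, smul_mul_assoc,
        dGamma_mul_create he, smul_add, Finset.sum_add_distrib, Finset.smul_sum, smul_smul,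
        Matrix.mul_apply, Finset.sum_smul]
      congr 1
      rw [Finset.sum_comm]
      refine Finset.sum_congr rfl fun i _ => Finset.sum_congr rfl fun l _ => ?_
      rw [mul_comm]
    exact (congrArg (NormedSpace.exp (dGamma e X) * ·) h1).symm.trans
      (exp_mul_map_one D (x := dGamma e X) (y := X) hcomm)
  commute η hη := (dGamma_mul_create_of_orthogonal X hη).exp_left
  vacuum := exp_apply_of_eigenvector (dGamma_vacuum he X)

/-- The vacuum scalar is a square root of the inverse determinant: for an exponential this is
Jacobi's formula, since the vacuum eigenvalue is minus half the trace, and both sides are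
multiplicative. -/
lemma exists_implements_of_mem_closure (he : Orthonormal ℂ e) {h : Op L}
    (hh : h ∈ Submonoid.closure (Set.range fun X => NormedSpace.exp (dGamma e X))) :
    ∃ X k, Implements e h X k ∧ k ^ 2 * X.det = 1 := by
  induction hh using Submonoid.closure_induction with
  | mem x hx =>
    obtain ⟨X, rfl⟩ := hx
    refine ⟨_, _, implements_exp_dGamma he X, ?_⟩
    rw [det_exp, ← Complex.exp_nat_mul, ← Complex.exp_add, Complex.exp_eq_one_iff]
    exact ⟨0, by push_cast; ring⟩
  | one => exact ⟨1, 1, Implements.one, by simp⟩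
  | mul x y _ _ hx hy =>
    obtain ⟨X, k, H, h1⟩ := hx
    obtain ⟨X', k', H', h2⟩ := hy
    refine ⟨_, _, H.mul H', ?_⟩
    rw [det_mul, mul_pow, mul_mul_mul_comm, h1, h2, one_mul]

/-- Logarithms of the eigenvalues give a logarithm of X, and the resulting vacuum scalar agrees with
k up to sign. -/
lemma mem_range_exp_dGamma_of_isDiagonalizable [Nonempty n] (he : Orthonormal ℂ e) {h : Op L}
    {X : Matrix n n ℂ} {k : ℂ} (H : Implements e h X k) (hk : k ^ 2 * X.det = 1)
    (hX : X.IsDiagonalizable) : ∃ Y, h = NormedSpace.exp (dGamma e Y) := by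
  obtain ⟨Q, d, hQ, rfl⟩ := hX
  have hQ' := (isUnit_iff_isUnit_det _).1 hQ
  rw [det_conj hQ, det_diagonal] at hk
  have hd : ∀ i, d i ≠ 0 := fun i hi => by
    rw [Finset.prod_eq_zero (Finset.mem_univ i) hi, mul_zero] at hk
    exact zero_ne_one hk
  have key : ∀ l : n → ℂ, (∀ i, Complex.exp (l i) = d i) →
      Complex.exp (-(1 / 2 * ∑ i, l i)) = k → ∃ Y, h = NormedSpace.exp (dGamma e Y) := by
    intro l hl hlk
    refine ⟨Q * diagonal l * Q⁻¹, H.eq he ?_⟩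
    have := implements_exp_dGamma he (Q * diagonal l * Q⁻¹)
    rw [exp_mul_diagonal_mul_inv hQ, trace_mul_cycle, nonsing_inv_mul _ hQ', one_mul,
      trace_diagonal, hlk] at this
    simpa only [hl] using this
  let l : n → ℂ := fun i => Complex.log (d i)
  have hl : ∀ i, Complex.exp (l i) = d i := fun i => Complex.exp_log (hd i)
  have hsq : Complex.exp (-(1 / 2 * ∑ i, l i)) ^ 2 = k ^ 2 := by
    have h1 : Complex.exp (-(1 / 2 * ∑ i, l i)) ^ 2 * ∏ i, d i = 1 := by
      simp only [← hl, ← Complex.exp_sum]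
      rw [← Complex.exp_nat_mul, ← Complex.exp_add, Complex.exp_eq_one_iff]
      exact ⟨0, by push_cast; ring⟩
    exact mul_right_cancel₀ (right_ne_zero_of_mul_eq_one h1) (h1.trans hk.symm)
  rcases sq_eq_sq_iff_eq_or_eq_neg.1 hsq with h1 | h1
  · exact key l hl h1
  · obtain ⟨i₀⟩ := ‹Nonempty n›
    -- Adding 2πi to one logarithm leaves X unchanged and flips the sign of the vacuum scalar.
    refine key (l + Pi.single i₀ (2 * Real.pi * Complex.I)) (fun i => ?_) ?_
    · rw [Pi.add_apply, Complex.exp_add, hl]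
      rcases eq_or_ne i i₀ with rfl | hi
      · rw [Pi.single_eq_same, Complex.exp_two_pi_mul_I, mul_one]
      · rw [Pi.single_eq_of_ne hi, Complex.exp_zero, mul_one]
    · have : -(1 / 2 * ∑ i, (l + Pi.single i₀ (2 * Real.pi * Complex.I) : n → ℂ) i) =
          -(1 / 2 * ∑ i, l i) + -(Real.pi * Complex.I) := by
        simp only [Pi.add_apply, Finset.sum_add_distrib, Finset.sum_pi_single', Finset.mem_univ,
          if_true]
        ring
      rw [this, Complex.exp_add, h1, Complex.exp_neg, Complex.exp_pi_mul_I]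
      norm_num

/-- Products of exponentials of current operators of matrices are limits of such
exponentials. -/
lemma closure_exp_dGamma_subset (he : Orthonormal ℂ e) :
    (Submonoid.closure (Set.range fun X => NormedSpace.exp (dGamma e X)) : Set (Op L)) ⊆
      closure (Set.range fun X => NormedSpace.exp (dGamma e X)) := by
  let : NormedAlgebra ℚ (Op L) := NormedAlgebra.restrictScalars ℚ ℂ (Op L)
  intro h hh
  rcases isEmpty_or_nonempty n with hn | hn
  · refine subset_closure ⟨0, ?_⟩
    have : Submonoid.closure (Set.range fun X => NormedSpace.exp (dGamma e X)) ≤ ⊥ := by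
      rw [Submonoid.closure_le]
      rintro _ ⟨X, rfl⟩
      simp [dGamma_apply]
    simp only [Submonoid.mem_bot.1 (this hh), map_zero, NormedSpace.exp_zero]
  · obtain ⟨X, k, H, hk⟩ := exists_implements_of_mem_closure he hh
    have hX : IsUnit X := by
      rw [isUnit_iff_isUnit_det]
      exact IsUnit.of_mul_eq_one_right _ hk
    have hc : Continuous fun Y : Matrix n n ℂ => h * NormedSpace.exp (dGamma e Y) :=
      continuous_const.mul (NormedSpace.exp_continuous.comp (continuous_dGamma e))
    -- A small Y makes X exp Y diagonalizable while h exp (dΓ(Y)) stays near h. This product is then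
    -- a single exponential.
    refine mem_closure_iff_nhds.2 fun V hV => ?_
    have hU : (fun Y : Matrix n n ℂ => h * NormedSpace.exp (dGamma e Y)) ⁻¹' V ∈
        nhds (0 : Matrix n n ℂ) := by
      refine hc.continuousAt ?_
      simpa using hV
    obtain ⟨Y, hY, hXY⟩ := exists_isDiagonalizable_mul_exp hX hU
    have H' := H.mul (implements_exp_dGamma he Y)
    obtain ⟨Z, hZ⟩ := mem_range_exp_dGamma_of_isDiagonalizable he H' (by
      obtain ⟨_, _⟩ := hXY
      rw [det_mul, det_exp, mul_pow, mul_mul_mul_comm, hk, one_mul, ← Complex.exp_nat_mul,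
        ← Complex.exp_add, Complex.exp_eq_one_iff]
      exact ⟨0, by push_cast; ring⟩) hXY
    exact ⟨_, hY, Z, hZ.symm⟩

/-- Only finitely many vectors occur in h. Allowing every family whose span contains W lets two
factors be expressed in a common family. -/
lemma exists_finiteDimensional_of_mem_currentMonoid {h : Op L} (hh : h ∈ currentMonoid L) :
    ∃ W : Submodule ℂ L, FiniteDimensional ℂ W ∧
      ∀ (N : ℕ) (e : Fin N → L), W ≤ Submodule.span ℂ (Set.range e) →
        h ∈ Submonoid.closure (Set.range fun X => NormedSpace.exp (dGamma e X)) := by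
  induction hh using Submonoid.closure_induction with
  | mem x hx =>
    obtain ⟨t, α, ξ, rfl⟩ := hx
    refine ⟨Submodule.span ℂ {α, ξ}, FiniteDimensional.span_of_finite ℂ (by simp),
      fun N e he => ?_⟩
    obtain ⟨u, rfl⟩ := (Submodule.mem_span_range_iff_exists_fun ℂ).1
      (he (Submodule.subset_span (Set.mem_insert α _)))
    obtain ⟨v, rfl⟩ := (Submodule.mem_span_range_iff_exists_fun ℂ).1
      (he (Submodule.subset_span (Set.mem_insert_of_mem _ rfl)))
    -- The conjugate on the coefficients of α comes from the conjugate linearity of creation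
    -- operators.
    refine Submonoid.subset_closure ⟨Matrix.of fun i j => t * (starRingEnd ℂ (u i) * v j), ?_⟩
    simp only
    congr 1
    have h1 : create (∑ i, u i • e i) = ∑ i, starRingEnd ℂ (u i) • create (e i) := by
      rw [← createL_apply, map_sum]
      simp only [createL_apply, create_smul]
    have h2 : annih (∑ i, v i • e i) = ∑ i, v i • annih (e i) := by
      rw [← annihL_apply, map_sum]
      simp only [annihL_apply, annih_smul]
    rw [rankOneCurrent, h1, h2, dGamma_apply, Finset.sum_mul_sum, sum_inner]
    simp only [inner_sum, inner_smul_left, inner_smul_right, rankOneCurrent, Matrix.of_apply,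
      Finset.mul_sum, Finset.sum_smul, ← Finset.sum_sub_distrib, Finset.smul_sum]
    refine Finset.sum_congr rfl fun i _ => Finset.sum_congr rfl fun j _ => ?_
    rw [smul_mul_smul_comm]
    module
  | one => exact ⟨⊥, inferInstance, fun N e _ => one_mem _⟩
  | mul x y _ _ hx hy =>
    obtain ⟨W, hW, hx⟩ := hx
    obtain ⟨W', hW', hy⟩ := hy
    exact ⟨W ⊔ W', inferInstance, fun N e he => mul_mem (hx N e (le_sup_left.trans he))
      (hy N e (le_sup_right.trans he))⟩

lemma currentMonoid_subset_closure_HC : (currentMonoid L : Set (Op L)) ⊆ closure (HC b) := by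
  intro h hh
  obtain ⟨W, hW, H⟩ := exists_finiteDimensional_of_mem_currentMonoid hh
  let e := stdOrthonormalBasis ℂ W
  have he : Orthonormal ℂ fun i => (e i : L) := e.orthonormal.comp_linearIsometry W.subtypeₗᵢ
  have hspan : W ≤ Submodule.span ℂ (Set.range fun i => (e i : L)) := by
    intro w hw
    refine (Submodule.mem_span_range_iff_exists_fun ℂ).2 ⟨fun i => e.repr ⟨w, hw⟩ i, ?_⟩
    simpa using congrArg Subtype.val (e.sum_repr ⟨w, hw⟩)
  refine closure_mono ?_ (closure_exp_dGamma_subset he (H _ _ hspan))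
  rintro _ ⟨X, rfl⟩
  exact exp_dGamma_mem_HC _ X

/-- Only the current factor needs approximation; the outer factors already lie in `PMinus` and
`PPlus`. -/
lemma bigCell_subset_closure : bigCell L ⊆ closure (PMinus b * HC b * PPlus b) := by
  rintro _ ⟨p, hp, h, hh, q, hq, rfl⟩
  refine map_mem_closure (f := fun x => p * x * q) (by fun_prop)
    (currentMonoid_subset_closure_HC (b := b) hh) fun x hx => ?_
  exact Set.mul_mem_mul (Set.mul_mem_mul (createMonoid_subset_PMinus hp) hx)
    (annihMonoid_subset_PPlus hq)

lemma zero_mem_hC : (0 : Op L) ∈ hC b := finiteCurrents_subset_hC (zero_mem _)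

lemma zero_mem_mPlus : (0 : Op L) ∈ mPlus b := finitePairs_subset_mPlus (zero_mem _)

lemma zero_mem_mMinus : (0 : Op L) ∈ mMinus b := ⟨0, zero_mem_mPlus, map_zero _⟩

lemma zero_mem_nPlus : (0 : Op L) ∈ nPlus L := annih_zero (L := L) ▸ annih_mem_nPlus 0

lemma zero_mem_nMinus : (0 : Op L) ∈ nMinus L := ⟨0, zero_mem_nPlus, map_zero _⟩

lemma hC_subset_gC : hC b ⊆ gC b := fun x hx =>
  ⟨x, ⟨x, hx, 0, ⟨0, zero_mem_mPlus, 0, zero_mem_mMinus, add_zero 0⟩, add_zero x⟩, 0,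
    ⟨0, zero_mem_nPlus, 0, zero_mem_nMinus, add_zero 0⟩, add_zero x⟩

lemma pPlus_subset_gC : pPlus b ⊆ gC b := by
  rintro _ ⟨x, hx, y, hy, rfl⟩
  exact ⟨x, ⟨0, zero_mem_hC, x, ⟨x, hx, 0, zero_mem_mMinus, add_zero x⟩, zero_add x⟩, y,
    ⟨y, hy, 0, zero_mem_nMinus, add_zero y⟩, rfl⟩

lemma pMinus_subset_gC : pMinus b ⊆ gC b := by
  rintro _ ⟨x, hx, y, hy, rfl⟩
  exact ⟨x, ⟨0, zero_mem_hC, x, ⟨0, zero_mem_mPlus, x, hx, zero_add x⟩, zero_add x⟩, y,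
    ⟨0, zero_mem_nPlus, y, hy, zero_add y⟩, rfl⟩

lemma mul_mem_GC {p h q : Op L} (hp : p ∈ PMinus b) (hh : h ∈ HC b) (hq : q ∈ PPlus b) :
    p * h * q ∈ GC b := by
  refine ⟨subset_closure (mul_mem (mul_mem ?_ ?_) ?_),
    ((isUnit_of_mem_PMinus hp).mul (isUnit_of_mem_HC hh)).mul (isUnit_of_mem_PPlus hq)⟩
  · exact Submonoid.subset_closure (Set.image_mono pMinus_subset_gC hp)
  · exact Submonoid.subset_closure (Set.image_mono hC_subset_gC hh)
  · exact Submonoid.subset_closure (Set.image_mono pPlus_subset_gC hq)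

end SecondQuantization

end

end FermiFock

/-! ### The decomposition theorem -/

theorem mainTheorem1 {L : Type*} [NormedAddCommGroup L] [InnerProductSpace ℂ L] [CompleteSpace L]
    [TopologicalSpace.SeparableSpace L] {ι : Type*} (b : HilbertBasis ι ℂ L) :
    ∃ m : FermiFock.PMinus b × FermiFock.HC b × FermiFock.PPlus b → FermiFock.GC b,
      (∀ (p : FermiFock.PMinus b) (h : FermiFock.HC b) (q : FermiFock.PPlus b),
        (m (p, h, q) : FermiFock.Fock L →L[ℂ] FermiFock.Fock L) = p * h * q) ∧
      Function.Injective m ∧ DenseRange m := by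
  refine ⟨fun x => ⟨x.1 * x.2.1 * x.2.2, FermiFock.mul_mem_GC x.1.2 x.2.1.2 x.2.2.2⟩,
    fun p h q => rfl, ?_, ?_⟩
  · rintro ⟨⟨p, hp⟩, ⟨h, hh⟩, q, hq⟩ ⟨⟨p', hp'⟩, ⟨h', hh'⟩, q', hq'⟩ e
    obtain ⟨rfl, rfl, rfl⟩ := FermiFock.factors_unique hp hp' hh hh' hq hq' (congrArg Subtype.val e)
    rfl
  · intro g
    -- Density in `GC` refers to the subspace topology, so it suffices to approximate g in the
    -- ambient operator norm by products phq.
    rw [Topology.IsInducing.subtypeVal.closure_eq_preimage_closure_image, Set.mem_preimage]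
    have h1 : (g : FermiFock.Op L) ∈ closure (FermiFock.bigCell L) :=
      closure_minimal FermiFock.GAlg_subset_closure_bigCell isClosed_closure g.2.1
    refine closure_mono ?_ (closure_minimal (FermiFock.bigCell_subset_closure (b := b))
      isClosed_closure h1)
    rintro _ ⟨_, ⟨p, hp, h, hh, rfl⟩, q, hq, rfl⟩
    exact ⟨_, ⟨(⟨p, hp⟩, ⟨h, hh⟩, ⟨q, hq⟩), rfl⟩, rfl⟩
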